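/- Let $K$ be a field, let $n\ge 1$, let $S=K[x_1,\dots,x_n]$ with the standard grading, and let $P_n$ be the path on $\{1,\dots,n\}$ with edges $\{1,2\},\{2,3\},\dots,\{n-1,n\}$. Let $J(P_n)\subseteq S$ be its vertex cover ideal, generated by the monomials $\prod_{v\in W}x_v$, where $W$ runs over the minimal vertex covers of $P_n$. For a homogeneous ideal $I$ of $S$ write $\beta_{i,j}(I)$ for the number of basis elements of degree $j$ in homological degree $i$ of the minimal graded free resolution of $I$ over $S$, write $\operatorname{projdim} I$ for the projective dimension of the $S$-module $I$, and, for $I\neq 0$, put $\operatorname{reg} I=\max\{j:\beta_{i,i+j}(I)\ne 0\text{ for some }i\}$. Then, for every integer $k\ge 0$: (i) if $n=3k$, then $\operatorname{projdim}J(P_n)=k$, $\operatorname{reg}J(P_n)=2k$ and $\beta_{k,3k}(J(P_{3k}))=1$; (ii) if $n=3k-1$, then $\operatorname{projdim}J(P_n)=k$, $\operatorname{reg}J(P_n)=2k-1$ and $\beta_{k,3k-1}(J(P_{3k-1}))=1$; (iii) if $n=3k+1$, then $\operatorname{projdim}J(P_n)=k$, $\operatorname{reg}J(P_n)=2k$ and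 $\beta_{k,3k}(J(P_{3k+1}))=k+1$. -/

import Mathlib

noncomputable section

/-- The vertex cover ideal of a graph `G`: the ideal of the polynomial ring over `K` in the vertices
of `G` generated by the squarefree monomials of the minimal vertex covers of `G`. -/
def vertexCoverIdeal (K : Type*) [Field K] {V : Type*} (G : SimpleGraph V) :
    Ideal (MvPolynomial V K) :=
  Ideal.span {m | ∃ W : Finset V,
    Minimal (fun s : Finset V => G.IsVertexCover (s : Set V)) W ∧ m = ∏ v ∈ W, MvPolynomial.X v}

/-- A graded free resolution `⋯ → F₂ → F₁ → F₀ → I → 0` of an ideal `I` of the standard graded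
polynomial ring `S = K[x_v : v ∈ V]`. Here `F i = ⨁_a S(-deg i a)` is free on `rank i` homogeneous
basis elements, the `a`-th of which has degree `deg i a`, and all maps are homogeneous of
degree `0`. -/
structure GradedFreeResolution {K V : Type*} [Field K] (I : Ideal (MvPolynomial V K)) where
  /-- the rank of the `i`-th free module -/
  rank : ℕ → ℕ
  /-- the degrees of the basis elements -/
  deg : ∀ i, Fin (rank i) → ℕ
  /-- the differential `F (i + 1) → F i` -/
  d : ∀ i, (Fin (rank (i + 1)) → MvPolynomial V K) →ₗ[MvPolynomial V K]
    (Fin (rank i) → MvPolynomial V K)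
  /-- the augmentation `F 0 → I` -/
  aug : (Fin (rank 0) → MvPolynomial V K) →ₗ[MvPolynomial V K] I
  aug_surjective : Function.Surjective aug
  exact_zero : Function.Exact (d 0) aug
  exact_succ : ∀ i, Function.Exact (d (i + 1)) (d i)
  aug_homogeneous : ∀ a,
    (aug (Pi.single a 1) : MvPolynomial V K).IsHomogeneous (deg 0 a)
  /-- An entry of the matrix of the differential is `0` or homogeneous, of the difference of
  the degrees of the two basis elements. -/
  d_homogeneous : ∀ i b a, d i (Pi.single b 1) a ≠ 0 →
    ∃ m, deg i a + m = deg (i + 1) b ∧ (d i (Pi.single b 1) a).IsHomogeneous m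

namespace GradedFreeResolution

variable {K V : Type*} [Field K] {I : Ideal (MvPolynomial V K)}

/-- A graded free resolution is minimal if all entries of the matrices of its differentials lie in
the ideal generated by the variables. -/
def IsMinimal (F : GradedFreeResolution I) : Prop :=
  ∀ i b a, F.d i (Pi.single b 1) a ∈
    Ideal.span (Set.range (MvPolynomial.X : V → MvPolynomial V K))

/-- The number of basis elements of degree `j` of the `i`-th free module. -/
def rankInDegree (F : GradedFreeResolution I) (i j : ℕ) : ℕ :=
  Fintype.card {a : Fin (F.rank i) // F.deg i a = j}

end GradedFreeResolution

open Classical in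
/-- The graded Betti number `β_{i,j}(I)`: the number of basis elements of degree `j` in homological
degree `i` of the minimal graded free resolution of `I`, which is unique up to isomorphism (and
exists if `I` is homogeneous and there are finitely many variables). -/
def gradedBetti {K V : Type*} [Field K] (I : Ideal (MvPolynomial V K)) (i j : ℕ) : ℕ :=
  if h : ∃ F : GradedFreeResolution I, F.IsMinimal then h.choose.rankInDegree i j else 0

/-- The Castelnuovo-Mumford regularity `max {j | β_{i,i+j}(I) ≠ 0 for some i}`. In the minimal graded
free resolution of an ideal, the `i`-th free module is generated in degrees at least `i`, so that
only natural numbers `j` occur. -/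
def regularity {K V : Type*} [Field K] (I : Ideal (MvPolynomial V K)) : WithBot ℕ∞ :=
  ⨆ (i : ℕ) (j : ℕ) (_ : gradedBetti I i (i + j) ≠ 0), ((j : ℕ∞) : WithBot ℕ∞)

/-- The projective dimension of an ideal as a module over the polynomial ring. -/
def projdim {K V : Type*} [Field K] (I : Ideal (MvPolynomial V K)) : WithBot ℕ∞ :=
  CategoryTheory.projectiveDimension (ModuleCat.of (MvPolynomial V K) I)

end

/-! Number the vertices from `0` and write `J m` for the ideal of the exponents that cover the edges
of the path on the first `m` vertices, always in the same ring. A cover of the path on `m + 3`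
vertices either contains `m + 1`, the neighbour of the last vertex, or it contains both `m` and `m +
2`. Hence `J (m + 3) = x A + y z B` with `A = J (m + 1)`, `B = J m`, and `x`, `y`, `z` the variables
of `m + 1`, `m + 2`, `m`.

Here `z B ⊆ A`, the prime `x` does not divide `y z`, and `x` is a nonzerodivisor modulo `B`. So `x A
∩ y z B = x y z B`, and there is an exact sequence `0 → B → A ⊕ B → J (m + 3) → 0`, up to degree
shifts, with first map `(y z, -x)`. If `φ` lifts multiplication by `z` to resolutions, then `(y φ,
-x)` lifts the first map and vanishes modulo the variables, so its mapping cone is again minimal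
(`MinimalResolution.cone`). This gives the exact recursion for Betti numbers recorded in
`pathBetti`.

By induction on the recursion, `β_{i,j} ≠ 0` forces `3 i ≤ m + 1` and `3 (j - i) ≤ 2 m`
(`le_of_pathBetti_ne_zero`). In each residue class of `n` modulo `3` one Betti number sits at the
corner of this region. It is computed from the recursion and is nonzero, so it determines both the
projective dimension and the regularity.

Two general facts link this to the definitions. Any two minimal resolutions have the same Betti
numbers (`MinimalResolution.betti_eq`), and the length of a minimal resolution is the projective
dimension (`MinimalResolution.projdim_eq`). -/

open MvPolynomial

/-! ### Homogeneous maps between graded free modules -/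

/-- A vector `g` of polynomials is homogeneous of degree `k` with respect to the degrees `w` of the
basis vectors. -/
def IsHomogeneousVec {K V ι : Type*} [Field K] (w : ι → ℕ) (k : ℤ) (g : ι → MvPolynomial V K) :
    Prop :=
  ∀ a e, coeff e (g a) ≠ 0 → (w a : ℤ) + (e.degree : ℤ) = k

/-- A linear map between graded free modules that raises degrees by `s`. -/
def IsHomogeneousMap {K V ι κ : Type*} [Field K] (w : ι → ℕ) (w' : κ → ℕ) (s : ℤ)
    (f : (ι → MvPolynomial V K) →ₗ[MvPolynomial V K] (κ → MvPolynomial V K)) : Prop :=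
  ∀ k g, IsHomogeneousVec w k g → IsHomogeneousVec w' (k + s) (f g)

section Homogeneous

variable {K V ι κ : Type*} [Field K]

theorem LinearMap.apply_eq_sum_smul_single [Fintype ι] [DecidableEq ι] {R M : Type*} [Semiring R]
    [AddCommMonoid M] [Module R M] (f : (ι → R) →ₗ[R] M) (g : ι → R) :
    f g = ∑ b, g b • f (Pi.single b 1) := by
  conv_lhs => rw [pi_eq_sum_univ' g]
  simp [map_sum, map_smul, Pi.single]

theorem LinearMap.apply_apply_eq_sum_mul_single [Fintype ι] [DecidableEq ι] {R : Type*}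
    [CommSemiring R] (f : (ι → R) →ₗ[R] (κ → R)) (g : ι → R) (a : κ) :
    f g a = ∑ b, g b * f (Pi.single b 1) a := by
  rw [f.apply_eq_sum_smul_single g]
  simp

theorem IsHomogeneousVec.single [DecidableEq ι] (w : ι → ℕ) (b : ι) :
    IsHomogeneousVec w (w b) (Pi.single b 1 : ι → MvPolynomial V K) := by
  classical
  intro a e h
  by_cases hab : a = b
  · subst hab
    rw [Pi.single_eq_same, coeff_one] at h
    have he : 0 = e := by
      by_contra h0
      exact h (if_neg h0)
    simp [← he]
  · simp [Pi.single_eq_of_ne hab] at h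

theorem IsHomogeneousVec.add {w : ι → ℕ} {k : ℤ} {g h : ι → MvPolynomial V K}
    (hg : IsHomogeneousVec w k g) (hh : IsHomogeneousVec w k h) : IsHomogeneousVec w k (g + h) := by
  intro a e he
  by_cases h0 : coeff e (g a) = 0
  · refine hh a e fun h1 => he ?_
    simp [h0, h1]
  · exact hg a e h0

theorem IsHomogeneousVec.neg {w : ι → ℕ} {k : ℤ} {g : ι → MvPolynomial V K}
    (hg : IsHomogeneousVec w k g) : IsHomogeneousVec w k (-g) := by
  intro a e he
  refine hg a e fun h1 => he ?_
  simp [h1]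

theorem IsHomogeneousVec.smul {w : ι → ℕ} {k : ℤ} {g : ι → MvPolynomial V K} {s : ℕ}
    {z : MvPolynomial V K} (hz : z.IsHomogeneous s)
    (hg : IsHomogeneousVec w k g) : IsHomogeneousVec w (k + s) (z • g) := by
  classical
  intro a e he
  rw [Pi.smul_apply, smul_eq_mul, coeff_mul] at he
  obtain ⟨⟨u, v⟩, huv, hne⟩ := Finset.exists_ne_zero_of_sum_ne_zero he
  have h1 : u.degree = s := by
    rw [Finsupp.degree_eq_weight_one (R := ℕ)]
    exact hz (left_ne_zero_of_mul hne)
  have h2 := hg a v (right_ne_zero_of_mul hne)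
  have h3 : u + v = e := Finset.HasAntidiagonal.mem_antidiagonal.mp huv
  have h4 : e.degree = u.degree + v.degree := by rw [← h3, map_add]
  omega

theorem isHomogeneousMap_of_single [Fintype ι] [DecidableEq ι] {w : ι → ℕ} {w' : κ → ℕ} {s : ℤ}
    {f : (ι → MvPolynomial V K) →ₗ[MvPolynomial V K] (κ → MvPolynomial V K)}
    (hf : ∀ b, IsHomogeneousVec w' (w b + s) (f (Pi.single b 1))) :
    IsHomogeneousMap w w' s f := by
  classical
  intro k g hg a e he
  rw [f.apply_apply_eq_sum_mul_single, coeff_sum] at he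
  obtain ⟨b, -, hb⟩ := Finset.exists_ne_zero_of_sum_ne_zero he
  rw [coeff_mul] at hb
  obtain ⟨⟨u, v⟩, huv, hne⟩ := Finset.exists_ne_zero_of_sum_ne_zero hb
  have h1 := hg b u (left_ne_zero_of_mul hne)
  have h2 := hf b a v (right_ne_zero_of_mul hne)
  have h3 : u + v = e := Finset.HasAntidiagonal.mem_antidiagonal.mp huv
  have h4 : e.degree = u.degree + v.degree := by rw [← h3, map_add]
  omega

/-- The component of degree `k` of a vector of polynomials. -/
noncomputable def vecComponent (w : ι → ℕ) (k : ℤ) (g : ι → MvPolynomial V K) :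
    ι → MvPolynomial V K :=
  fun a => if (w a : ℤ) ≤ k then homogeneousComponent (k - w a).toNat (g a) else 0

theorem coeff_vecComponent (w : ι → ℕ) (k : ℤ) (g : ι → MvPolynomial V K) (a : ι) (e : V →₀ ℕ) :
    coeff e (vecComponent w k g a) =
      if (w a : ℤ) + (e.degree : ℤ) = k then coeff e (g a) else 0 := by
  unfold vecComponent
  split_ifs with h1 h2 h2
  · rw [coeff_homogeneousComponent, if_pos]
    omega
  · rw [coeff_homogeneousComponent, if_neg]
    omega
  · omega
  · simp

theorem vecComponent_isHomogeneousVec (w : ι → ℕ) (k : ℤ) (g : ι → MvPolynomial V K) :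
    IsHomogeneousVec w k (vecComponent w k g) := by
  intro a e h
  rw [coeff_vecComponent] at h
  by_contra h'
  exact h (if_neg h')

theorem IsHomogeneousVec.vecComponent_eq {w : ι → ℕ} {k : ℤ} {g : ι → MvPolynomial V K}
    (hg : IsHomogeneousVec w k g) : vecComponent w k g = g := by
  funext a
  ext e
  rw [coeff_vecComponent]
  split_ifs with h
  · rfl
  · by_contra h'
    exact h (hg a e fun h0 => h' h0.symm)

/-- Every term of the entry of `f` from `b` to `a` has degree `w b - w' a`. A product of terms
therefore contributes to degree `k` of `f g` exactly when its factor from `g` lies in degree `k`. -/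
theorem IsHomogeneousMap.map_vecComponent [Fintype ι] [DecidableEq ι] {w : ι → ℕ} {w' : κ → ℕ}
    {f : (ι → MvPolynomial V K) →ₗ[MvPolynomial V K] (κ → MvPolynomial V K)}
    (hf : IsHomogeneousMap w w' 0 f) (k : ℤ) (g : ι → MvPolynomial V K) :
    f (vecComponent w k g) = vecComponent w' k (f g) := by
  classical
  funext a
  ext e
  rw [coeff_vecComponent, f.apply_apply_eq_sum_mul_single, f.apply_apply_eq_sum_mul_single,
    coeff_sum, coeff_sum]
  simp only [coeff_mul, coeff_vecComponent]
  have key : ∀ b, ∀ p ∈ Finset.HasAntidiagonal.antidiagonal e,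
      coeff p.2 (f (Pi.single b 1) a) ≠ 0 →
        ((w b : ℤ) + (p.1.degree : ℤ) = k ↔ (w' a : ℤ) + (e.degree : ℤ) = k) := by
    intro b p hp hM
    have h2 := hf _ _ (IsHomogeneousVec.single w b) a p.2 hM
    have h3 : p.1 + p.2 = e := Finset.HasAntidiagonal.mem_antidiagonal.mp hp
    have h4 : e.degree = p.1.degree + p.2.degree := by rw [← h3, map_add]
    omega
  split_ifs with h
  · refine Finset.sum_congr rfl fun b _ => Finset.sum_congr rfl fun p hp => ?_
    by_cases hM : coeff p.2 (f (Pi.single b 1) a) = 0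
    · simp [hM]
    · rw [if_pos ((key b p hp hM).mpr h)]
  · refine Finset.sum_eq_zero fun b _ => Finset.sum_eq_zero fun p hp => ?_
    by_cases hM : coeff p.2 (f (Pi.single b 1) a) = 0
    · simp [hM]
    · rw [if_neg (mt (key b p hp hM).mp h), zero_mul]

/-- A homogeneous element of the range of a homogeneous map has a homogeneous preimage. -/
theorem IsHomogeneousMap.exists_homogeneous_preimage [Fintype ι] {w : ι → ℕ}
    {w' : κ → ℕ} {f : (ι → MvPolynomial V K) →ₗ[MvPolynomial V K] (κ → MvPolynomial V K)}
    (hf : IsHomogeneousMap w w' 0 f) {k : ℤ} {y : κ → MvPolynomial V K}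
    (hy : IsHomogeneousVec w' k y) (hr : y ∈ LinearMap.range f) :
    ∃ x, IsHomogeneousVec w k x ∧ f x = y := by
  classical
  obtain ⟨x, rfl⟩ := hr
  exact ⟨vecComponent w k x, vecComponent_isHomogeneousVec w k x,
    (hf.map_vecComponent k x).trans hy.vecComponent_eq⟩

/-- Homogeneous maps out of graded free modules lift through homogeneous maps. -/
theorem IsHomogeneousMap.exists_lift {μ : Type*} [Fintype ι] [Fintype μ]
    {w : ι → ℕ} {w' : κ → ℕ} {u : μ → ℕ} {s : ℤ}
    {f : (ι → MvPolynomial V K) →ₗ[MvPolynomial V K] (κ → MvPolynomial V K)}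
    {g : (μ → MvPolynomial V K) →ₗ[MvPolynomial V K] (κ → MvPolynomial V K)}
    (hf : IsHomogeneousMap w w' 0 f) (hg : IsHomogeneousMap u w' s g)
    (hr : ∀ x, g x ∈ LinearMap.range f) :
    ∃ φ : (μ → MvPolynomial V K) →ₗ[MvPolynomial V K] (ι → MvPolynomial V K),
      IsHomogeneousMap u w s φ ∧ ∀ x, f (φ x) = g x := by
  classical
  choose y hy hfy using fun b : μ =>
    hf.exists_homogeneous_preimage (hg _ _ (IsHomogeneousVec.single u b)) (hr _)
  let φ := (Pi.basisFun (MvPolynomial V K) μ).constr (MvPolynomial V K) y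
  have hφ : ∀ b, φ (Pi.single b 1) = y b := fun b => by
    have := (Pi.basisFun (MvPolynomial V K) μ).constr_basis (MvPolynomial V K) y b
    rwa [Pi.basisFun_apply] at this
  refine ⟨φ, isHomogeneousMap_of_single fun b => by rw [hφ]; exact hy b, fun x => ?_⟩
  have : f ∘ₗ φ = g := (Pi.basisFun (MvPolynomial V K) μ).ext fun b => by
    rw [Pi.basisFun_apply, LinearMap.comp_apply, hφ, hfy]
  exact LinearMap.congr_fun this x

end Homogeneous

/-! ### Minimal resolutions and the uniqueness of their Betti numbers -/

/-- A minimal graded free resolution of an ideal, with arbitrary finite types indexing the bases;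
the augmentation takes values in the ring itself, regarded as a free module of rank one. -/
structure MinimalResolution {K V : Type*} [Field K] (I : Ideal (MvPolynomial V K)) where
  /-- the index type of the basis of the `i`-th free module -/
  ι : ℕ → Type
  [fintype : ∀ i, Fintype (ι i)]
  /-- the degrees of the basis elements -/
  deg : ∀ i, ι i → ℕ
  /-- the augmentation -/
  aug : (ι 0 → MvPolynomial V K) →ₗ[MvPolynomial V K] (Unit → MvPolynomial V K)
  /-- the differential -/
  d : ∀ i, (ι (i + 1) → MvPolynomial V K) →ₗ[MvPolynomial V K] (ι i → MvPolynomial V K)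
  mem_iff : ∀ p, p ∈ I ↔ ∃ x, aug x () = p
  exact_zero : ∀ x, aug x = 0 ↔ ∃ y, d 0 y = x
  exact_succ : ∀ i x, d i x = 0 ↔ ∃ y, d (i + 1) y = x
  aug_homogeneous : IsHomogeneousMap (deg 0) (fun _ => 0) 0 aug
  d_homogeneous : ∀ i, IsHomogeneousMap (deg (i + 1)) (deg i) 0 (d i)
  minimal : ∀ i g a, constantCoeff (d i g a) = 0

attribute [instance] MinimalResolution.fintype

/-- The ungraded lifting property of free modules; it supplies homotopies and retractions, where
degrees play no role. -/
theorem LinearMap.exists_lift_of_mem_range {R M N ι : Type*} [CommRing R] [AddCommGroup M]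
    [AddCommGroup N] [Module R M] [Module R N] [Fintype ι] (f : M →ₗ[R] N) (g : (ι → R) →ₗ[R] N)
    (h : ∀ x, ∃ y, f y = g x) : ∃ φ : (ι → R) →ₗ[R] M, ∀ x, f (φ x) = g x := by
  classical
  choose y hy using fun b : ι => h (Pi.single b 1)
  refine ⟨(Pi.basisFun R ι).constr R y, fun x => ?_⟩
  have : f ∘ₗ (Pi.basisFun R ι).constr R y = g := (Pi.basisFun R ι).ext fun b => by
    rw [LinearMap.comp_apply, Module.Basis.constr_basis, hy, Pi.basisFun_apply]
  exact LinearMap.congr_fun this x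

theorem constantCoeff_map_eq_zero {K V ι κ : Type*} [Field K] [Fintype ι]
    (f : (ι → MvPolynomial V K) →ₗ[MvPolynomial V K] (κ → MvPolynomial V K))
    {g : ι → MvPolynomial V K} (hg : ∀ a, constantCoeff (g a) = 0) (a : κ) :
    constantCoeff (f g a) = 0 := by
  classical
  rw [f.apply_apply_eq_sum_mul_single, map_sum]
  exact Finset.sum_eq_zero fun b _ => by rw [map_mul, hg, zero_mul]

namespace MinimalResolution

variable {K V : Type*} [Field K] {I A B : Ideal (MvPolynomial V K)}

theorem aug_d (F : MinimalResolution I) (x : F.ι 1 → MvPolynomial V K) : F.aug (F.d 0 x) = 0 :=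
  (F.exact_zero _).mpr ⟨x, rfl⟩

theorem d_d (F : MinimalResolution I) (i : ℕ) (x : F.ι (i + 2) → MvPolynomial V K) :
    F.d i (F.d (i + 1) x) = 0 :=
  (F.exact_succ i _).mpr ⟨x, rfl⟩

/-- Multiplication by a homogeneous polynomial `z` with `z B ⊆ A` lifts to a homogeneous map of
resolutions. -/
theorem exists_chainMap (F : MinimalResolution B) (G : MinimalResolution A)
    {z : MvPolynomial V K} {s : ℕ} (hz : z.IsHomogeneous s) (hBA : ∀ b ∈ B, z * b ∈ A) :
    ∃ φ : ∀ i, (F.ι i → MvPolynomial V K) →ₗ[MvPolynomial V K] (G.ι i → MvPolynomial V K),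
      (∀ i, IsHomogeneousMap (F.deg i) (G.deg i) s (φ i)) ∧
      (∀ x, G.aug (φ 0 x) = z • F.aug x) ∧
      ∀ i x, G.d i (φ (i + 1) x) = φ i (F.d i x) := by
  -- Each stage carries the condition that `φ ∘ d` takes values in the boundaries, which is what the
  -- lift at the next stage needs.
  let T (i : ℕ) := {φ : (F.ι i → MvPolynomial V K) →ₗ[MvPolynomial V K] (G.ι i → MvPolynomial V K) //
    IsHomogeneousMap (F.deg i) (G.deg i) s φ ∧ ∀ x, ∃ y, G.d i y = φ (F.d i x)}
  have base : ∃ t : T 0, ∀ x, G.aug (t.1 x) = z • F.aug x := by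
    obtain ⟨φ, hφ, hc⟩ := G.aug_homogeneous.exists_lift (g := z • F.aug) (u := F.deg 0) (s := s)
      (fun k g hg => by
        have := (F.aug_homogeneous k g hg).smul hz
        rwa [add_zero] at this)
      (fun x => by
        obtain ⟨y, hy⟩ := (G.mem_iff _).mp (hBA _ ((F.mem_iff _).mpr ⟨x, rfl⟩))
        exact ⟨y, funext fun _ => hy⟩)
    refine ⟨⟨φ, hφ, fun x => (G.exact_zero _).mp ?_⟩, hc⟩
    rw [hc, LinearMap.smul_apply, F.aug_d, smul_zero]
  have step : ∀ i (t : T i), ∃ t' : T (i + 1), ∀ x, G.d i (t'.1 x) = t.1 (F.d i x) := by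
    rintro i ⟨t, ht, hr⟩
    obtain ⟨φ, hφ, hc⟩ := (G.d_homogeneous i).exists_lift (g := t ∘ₗ F.d i)
      (u := F.deg (i + 1)) (s := s)
      (fun k g hg => by
        have := ht _ _ (F.d_homogeneous i k g hg)
        rwa [add_zero] at this)
      (fun x => hr x)
    refine ⟨⟨φ, hφ, fun x => (G.exact_succ i _).mp ?_⟩, hc⟩
    rw [hc, LinearMap.comp_apply, F.d_d, map_zero]
  obtain ⟨t₀, h₀⟩ := base
  choose next hnext using step
  let t : ∀ i, T i := fun i => Nat.rec t₀ next i
  exact ⟨fun i => (t i).1, fun i => (t i).2.1, h₀, fun i x => hnext i (t i) x⟩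

/-- An endomorphism of a minimal resolution that lifts the zero map vanishes modulo the variables. -/
theorem constantCoeff_eq_zero_of_lifts_zero (F : MinimalResolution I)
    (θ : ∀ i, (F.ι i → MvPolynomial V K) →ₗ[MvPolynomial V K] (F.ι i → MvPolynomial V K))
    (h₀ : ∀ x, F.aug (θ 0 x) = 0) (hd : ∀ i x, F.d i (θ (i + 1) x) = θ i (F.d i x)) (i : ℕ) :
    ∀ x a, constantCoeff (θ i x a) = 0 := by
  -- The map `s` is one component of a null-homotopy. The identity `θ d = d s d` is all that has to
  -- be remembered of it: it makes `θ - s d` land in the cycles at the next stage. Both summands of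
  -- `θ = d s' + s d` then vanish modulo the variables by minimality.
  suffices h : ∃ s : (F.ι i → MvPolynomial V K) →ₗ[MvPolynomial V K]
      (F.ι (i + 1) → MvPolynomial V K), (∀ x, θ i (F.d i x) = F.d i (s (F.d i x))) ∧
      ∀ x a, constantCoeff (θ i x a) = 0 from h.choose_spec.2
  induction i with
  | zero =>
    obtain ⟨s, hs⟩ := (F.d 0).exists_lift_of_mem_range (θ 0) fun x => (F.exact_zero _).mp (h₀ x)
    exact ⟨s, fun x => (hs _).symm, fun x a => by rw [← hs]; exact F.minimal _ _ _⟩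
  | succ i ih =>
    obtain ⟨s, hs, -⟩ := ih
    obtain ⟨s', hs'⟩ := (F.d (i + 1)).exists_lift_of_mem_range (θ (i + 1) - s ∘ₗ F.d i)
      fun x => (F.exact_succ i _).mp (by
        rw [LinearMap.sub_apply, map_sub, hd, hs, LinearMap.comp_apply, sub_self])
    have hθ : ∀ x, θ (i + 1) x = F.d (i + 1) (s' x) + s (F.d i x) := fun x => by
      rw [hs', LinearMap.sub_apply, LinearMap.comp_apply, sub_add_cancel]
    refine ⟨s', fun x => ?_, fun x a => ?_⟩
    · rw [hθ, F.d_d, map_zero, add_zero]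
    · rw [hθ, Pi.add_apply, map_add, F.minimal, constantCoeff_map_eq_zero s (F.minimal i x),
        add_zero]

/-- The number of basis elements of degree `j` of the `i`-th free module. -/
noncomputable def betti (F : MinimalResolution I) (i j : ℕ) : ℕ :=
  Nat.card {a : F.ι i // F.deg i a = j}

/-- Lift the identity of `I` to chain maps `φ` and `ψ` in both directions. Then `ψ φ - 1` lifts
zero, so the matrices of constant terms satisfy `Ψ Φ = 1` in each degree, and `Φ` is injective. -/
theorem betti_le (F G : MinimalResolution I) (i j : ℕ) : F.betti i j ≤ G.betti i j := by
  classical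
  have hI : ∀ b ∈ I, 1 * b ∈ I := fun b hb => by rwa [one_mul]
  obtain ⟨φ, hφ, hφ₀, hφd⟩ := F.exists_chainMap G (isHomogeneous_one V K) hI
  obtain ⟨ψ, hψ, hψ₀, hψd⟩ := G.exists_chainMap F (isHomogeneous_one V K) hI
  have hθ := F.constantCoeff_eq_zero_of_lifts_zero (fun i => ψ i ∘ₗ φ i - LinearMap.id)
    (fun x => by simp [hφ₀, hψ₀]) (fun i x => by simp [hφd, hψd]) i
  let Φ : Matrix {a : G.ι i // G.deg i a = j} {a : F.ι i // F.deg i a = j} K :=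
    fun a b => constantCoeff (φ i (Pi.single b.1 1) a.1)
  let Ψ : Matrix {a : F.ι i // F.deg i a = j} {a : G.ι i // G.deg i a = j} K :=
    fun a b => constantCoeff (ψ i (Pi.single b.1 1) a.1)
  have hΨΦ : Ψ * Φ = 1 := by
    ext a b
    have h1 := hθ (Pi.single b.1 1) a.1
    rw [LinearMap.sub_apply, LinearMap.id_apply, LinearMap.comp_apply, Pi.sub_apply, map_sub,
      sub_eq_zero, (ψ i).apply_apply_eq_sum_mul_single, map_sum] at h1
    -- A map of degree `0` has nonzero constant terms only between basis elements of equal degree,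
    -- so the sum over all of `G.ι i` reduces to degree `j`.
    have h2 : ∀ c : G.ι i, G.deg i c ≠ j → constantCoeff (φ i (Pi.single b.1 1) c) = 0 := by
      intro c hc
      by_contra h
      have := hφ i _ _ (IsHomogeneousVec.single (F.deg i) b.1) c 0 h
      have hb := b.2
      simp at this
      omega
    rw [Matrix.mul_apply]
    have h3 : ∑ c : {a : G.ι i // G.deg i a = j}, Ψ a c * Φ c b =
        ∑ c : G.ι i, constantCoeff (φ i (Pi.single b.1 1) c * ψ i (Pi.single c 1) a.1) := by
      rw [← Finset.sum_filter_of_ne (p := fun c => G.deg i c = j),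
        Finset.sum_subtype (p := fun c => G.deg i c = j) _ (by simp)]
      · exact Finset.sum_congr rfl fun c _ => by rw [map_mul, mul_comm]
      · intro c _ hne
        by_contra hc
        exact hne (by rw [map_mul, h2 c hc, zero_mul])
    rw [h3, h1, Matrix.one_apply, Pi.single_apply]
    simp only [Subtype.ext_iff]
    split_ifs <;> simp
  have hinj : Function.Injective Φ.mulVecLin := fun x y hxy => by
    have := congrArg Ψ.mulVec hxy
    simpa [Matrix.mulVec_mulVec, hΨΦ] using this
  have := LinearMap.finrank_le_finrank_of_injective hinj
  simpa [betti, Nat.card_eq_fintype_card] using this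

theorem betti_eq (F G : MinimalResolution I) (i j : ℕ) : F.betti i j = G.betti i j :=
  (F.betti_le G i j).antisymm (G.betti_le F i j)

end MinimalResolution

/-! ### Passage between `MinimalResolution` and `GradedFreeResolution` -/

open CategoryTheory

theorem MvPolynomial.mem_span_range_X_iff_constantCoeff {K V : Type*} [Field K]
    (p : MvPolynomial V K) :
    p ∈ Ideal.span (Set.range (X : V → MvPolynomial V K)) ↔ constantCoeff p = 0 := by
  rw [← Set.image_univ, mem_ideal_span_X_image]
  constructor
  · intro h
    by_contra h0
    obtain ⟨i, -, hi⟩ := h 0 (mem_support_iff.mpr h0)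
    exact hi rfl
  · intro h m hm
    have hm0 : m ≠ 0 := by
      rintro rfl
      exact mem_support_iff.mp hm h
    obtain ⟨i, hi⟩ := Finsupp.ne_iff.mp hm0
    exact ⟨i, trivial, hi⟩

theorem isHomogeneous_iff_forall_degree {K V : Type*} [Field K] (p : MvPolynomial V K) (m : ℕ) :
    p.IsHomogeneous m ↔ ∀ e, coeff e p ≠ 0 → e.degree = m := by
  unfold MvPolynomial.IsHomogeneous MvPolynomial.IsWeightedHomogeneous
  rw [Finsupp.degree_eq_weight_one (R := ℕ)]
  rfl

section Conversion

variable {K V : Type*} [Field K] {I : Ideal (MvPolynomial V K)}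

/-- A minimal graded free resolution, with its augmentation composed with the inclusion of the
ideal. -/
noncomputable def GradedFreeResolution.toMinimalResolution (F : GradedFreeResolution I)
    (hF : F.IsMinimal) : MinimalResolution I where
  ι i := Fin (F.rank i)
  deg := F.deg
  aug := LinearMap.pi fun _ => I.subtype ∘ₗ F.aug
  d := F.d
  mem_iff p := by
    constructor
    · intro hp
      obtain ⟨x, hx⟩ := F.aug_surjective ⟨p, hp⟩
      exact ⟨x, by simp [hx]⟩
    · rintro ⟨x, rfl⟩
      simp
  exact_zero x := by
    rw [← Set.mem_range, ← F.exact_zero x]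
    constructor
    · intro h
      exact Subtype.ext (congrFun h ())
    · intro h
      funext _
      simp [h]
  exact_succ i x := F.exact_succ i x
  aug_homogeneous := isHomogeneousMap_of_single fun b a e he => by
    have := (isHomogeneous_iff_forall_degree _ _).mp (F.aug_homogeneous b) e he
    simp [this]
  d_homogeneous i := isHomogeneousMap_of_single fun b a e he => by
    obtain ⟨m, hm, hh⟩ := F.d_homogeneous i b a fun h => he (by rw [h, coeff_zero])
    have := (isHomogeneous_iff_forall_degree _ _).mp hh e he
    omega
  minimal i g a := by
    rw [(F.d i).apply_apply_eq_sum_mul_single, map_sum]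
    refine Finset.sum_eq_zero fun b _ => ?_
    rw [map_mul, (mem_span_range_X_iff_constantCoeff _).mp (hF i b a), mul_zero]

namespace MinimalResolution

/-- The coordinate change that numbers the basis elements. -/
noncomputable def coordEquiv (R : MinimalResolution I) (i : ℕ) :
    (Fin (Fintype.card (R.ι i)) → MvPolynomial V K) ≃ₗ[MvPolynomial V K]
      (R.ι i → MvPolynomial V K) :=
  LinearEquiv.funCongrLeft _ _ (Fintype.equivFin (R.ι i))

theorem coordEquiv_single (R : MinimalResolution I) (i : ℕ) [DecidableEq (R.ι i)] (b) :
    R.coordEquiv i (Pi.single b 1) = Pi.single ((Fintype.equivFin (R.ι i)).symm b) 1 := by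
  funext a
  simp [coordEquiv, LinearEquiv.funCongrLeft, Pi.single_apply, LinearMap.funLeft, Equiv.eq_symm_apply]

/-- Numbering the basis elements turns a minimal resolution into a `GradedFreeResolution`. -/
noncomputable def toGradedFreeResolution (R : MinimalResolution I) : GradedFreeResolution I where
  rank i := Fintype.card (R.ι i)
  deg i a := R.deg i ((Fintype.equivFin (R.ι i)).symm a)
  d i := (R.coordEquiv i).symm.toLinearMap ∘ₗ R.d i ∘ₗ (R.coordEquiv (i + 1)).toLinearMap
  aug := LinearMap.codRestrict I (LinearMap.proj () ∘ₗ R.aug ∘ₗ (R.coordEquiv 0).toLinearMap)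
    fun x => (R.mem_iff _).mpr ⟨R.coordEquiv 0 x, rfl⟩
  aug_surjective p := by
    obtain ⟨x, hx⟩ := (R.mem_iff _).mp p.2
    exact ⟨(R.coordEquiv 0).symm x, Subtype.ext (by simp [hx])⟩
  exact_zero x := by
    have h : R.aug (R.coordEquiv 0 x) () = 0 ↔ R.aug (R.coordEquiv 0 x) = 0 :=
      ⟨fun h => funext fun _ => h, fun h => by rw [h]; rfl⟩
    rw [Subtype.ext_iff]
    refine h.trans ((R.exact_zero _).trans ⟨?_, ?_⟩)
    · rintro ⟨y, hy⟩
      exact ⟨(R.coordEquiv 1).symm y, by simp [hy]⟩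
    · rintro ⟨y, rfl⟩
      exact ⟨R.coordEquiv 1 y, by simp⟩
  exact_succ i x := by
    have h : R.d i (R.coordEquiv (i + 1) x) = 0 ↔
        (R.coordEquiv i).symm (R.d i (R.coordEquiv (i + 1) x)) = 0 := by simp
    refine h.symm.trans ((R.exact_succ i _).trans ⟨?_, ?_⟩)
    · rintro ⟨y, hy⟩
      exact ⟨(R.coordEquiv (i + 2)).symm y, by simp [hy]⟩
    · rintro ⟨y, rfl⟩
      exact ⟨R.coordEquiv (i + 2) y, by simp⟩
  aug_homogeneous a := by
    classical
    rw [isHomogeneous_iff_forall_degree]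
    intro e he
    have := R.aug_homogeneous _ _ (IsHomogeneousVec.single (R.deg 0)
      ((Fintype.equivFin (R.ι 0)).symm a)) () e (by
        rw [← coordEquiv_single]; exact he)
    simpa using this
  d_homogeneous i b a hne := by
    classical
    have key : ∀ e, coeff e (R.d i (R.coordEquiv (i + 1) (Pi.single b 1))
        ((Fintype.equivFin (R.ι i)).symm a)) ≠ 0 →
        R.deg i ((Fintype.equivFin (R.ι i)).symm a) + e.degree =
          R.deg (i + 1) ((Fintype.equivFin (R.ι (i + 1))).symm b) := fun e he => by
      have := R.d_homogeneous i _ _ (IsHomogeneousVec.single (R.deg (i + 1))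
        ((Fintype.equivFin (R.ι (i + 1))).symm b)) ((Fintype.equivFin (R.ι i)).symm a) e (by
          rw [← coordEquiv_single]; exact he)
      omega
    obtain ⟨e, he⟩ := exists_coeff_ne_zero hne
    refine ⟨e.degree, key e he, (isHomogeneous_iff_forall_degree _ _).mpr fun e' he' => ?_⟩
    have h1 := key e he
    have h2 := key e' he'
    omega

theorem toGradedFreeResolution_isMinimal (R : MinimalResolution I) :
    R.toGradedFreeResolution.IsMinimal := fun i _ _ =>
  (mem_span_range_X_iff_constantCoeff _).mpr (R.minimal i _ _)

/-- The graded Betti numbers can be read off any minimal resolution. -/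
theorem gradedBetti_eq (R : MinimalResolution I) (i j : ℕ) : gradedBetti I i j = R.betti i j := by
  have h : ∃ F : GradedFreeResolution I, F.IsMinimal := ⟨_, R.toGradedFreeResolution_isMinimal⟩
  rw [gradedBetti, dif_pos h, R.betti_eq (h.choose.toMinimalResolution h.choose_spec)]
  rw [betti, Nat.card_eq_fintype_card, GradedFreeResolution.rankInDegree]
  rfl

end MinimalResolution

end Conversion

/-! ### Projective dimension as the length of a minimal resolution -/

section ProjectiveDimension

universe u

variable {R : Type u} [CommRing R]

theorem hasProjectiveDimensionLT_of_surjective {M N : Type u} [AddCommGroup M] [Module R M]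
    [AddCommGroup N] [Module R N] [Module.Projective R M] {f : M →ₗ[R] N}
    (hf : Function.Surjective f) {n : ℕ}
    (h : HasProjectiveDimensionLT (ModuleCat.of R (LinearMap.ker f)) n) :
    HasProjectiveDimensionLT (ModuleCat.of R N) (n + 1) := by
  have hp : Projective (ModuleCat.of R M) := inferInstance
  have h2 : HasProjectiveDimensionLT (ModuleCat.of R M) 1 :=
    projective_iff_hasProjectiveDimensionLT_one.mp hp
  exact (LinearMap.shortExact_shortComplexKer hf).hasProjectiveDimensionLT_X₃ n h
    (hasProjectiveDimensionLT_of_ge _ 1 (n + 1) (by omega))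

theorem hasProjectiveDimensionLT_ker {M N : Type u} [AddCommGroup M] [Module R M]
    [AddCommGroup N] [Module R N] [Module.Projective R M] {f : M →ₗ[R] N}
    (hf : Function.Surjective f) {n : ℕ}
    (h : HasProjectiveDimensionLT (ModuleCat.of R N) (n + 2)) :
    HasProjectiveDimensionLT (ModuleCat.of R (LinearMap.ker f)) (n + 1) :=
  ((LinearMap.shortExact_shortComplexKer hf).hasProjectiveDimensionLT_X₃_iff n
    (inferInstanceAs (Projective (ModuleCat.of R M)))).mp h

end ProjectiveDimension

namespace MinimalResolution

variable {K V : Type*} [Field K] {I : Ideal (MvPolynomial V K)}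

/-- The syzygy modules: the kernels of the maps of a resolution. -/
noncomputable def cycles (F : MinimalResolution I) :
    ∀ i, Submodule (MvPolynomial V K) (F.ι i → MvPolynomial V K)
  | 0 => LinearMap.ker F.aug
  | i + 1 => LinearMap.ker (F.d i)

theorem mem_cycles_iff (F : MinimalResolution I) (i : ℕ) (x : F.ι i → MvPolynomial V K) :
    x ∈ F.cycles i ↔ ∃ y, F.d i y = x := by
  cases i with
  | zero => exact F.exact_zero x
  | succ i => exact F.exact_succ i x

/-- The augmentation onto the ideal. -/
noncomputable def toIdeal (F : MinimalResolution I) :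
    (F.ι 0 → MvPolynomial V K) →ₗ[MvPolynomial V K] I :=
  LinearMap.codRestrict I (LinearMap.proj () ∘ₗ F.aug) fun x => (F.mem_iff _).mpr ⟨x, rfl⟩

theorem toIdeal_surjective (F : MinimalResolution I) : Function.Surjective F.toIdeal := fun p => by
  obtain ⟨x, hx⟩ := (F.mem_iff _).mp p.2
  exact ⟨x, Subtype.ext hx⟩

theorem ker_toIdeal (F : MinimalResolution I) : LinearMap.ker F.toIdeal = F.cycles 0 := by
  ext x
  rw [LinearMap.mem_ker, Subtype.ext_iff]
  exact ⟨fun h => funext fun _ => h, fun h => congrFun h ()⟩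

/-- The differential onto the cycles. -/
noncomputable def toCycles (F : MinimalResolution I) (i : ℕ) :
    (F.ι (i + 1) → MvPolynomial V K) →ₗ[MvPolynomial V K] F.cycles i :=
  LinearMap.codRestrict _ (F.d i) fun x => (F.mem_cycles_iff i _).mpr ⟨x, rfl⟩

theorem toCycles_surjective (F : MinimalResolution I) (i : ℕ) :
    Function.Surjective (F.toCycles i) := fun p => by
  obtain ⟨x, hx⟩ := (F.mem_cycles_iff i _).mp p.2
  exact ⟨x, Subtype.ext hx⟩

theorem ker_toCycles (F : MinimalResolution I) (i : ℕ) :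
    LinearMap.ker (F.toCycles i) = F.cycles (i + 1) := by
  rw [toCycles, LinearMap.ker_codRestrict]
  rfl

/-- If a quotient of a free module by the image of a minimal map is projective, then the map has
no source. -/
theorem isEmpty_of_projective {ι κ N : Type*} [Fintype ι] [Fintype κ] [AddCommGroup N]
    [Module (MvPolynomial V K) N] [Module.Projective (MvPolynomial V K) N]
    {f : (ι → MvPolynomial V K) →ₗ[MvPolynomial V K] N} (hf : Function.Surjective f)
    {g : (κ → MvPolynomial V K) →ₗ[MvPolynomial V K] (ι → MvPolynomial V K)}
    (hfg : ∀ x, f x = 0 ↔ ∃ y, g y = x) (hg : ∀ y a, constantCoeff (g y a) = 0)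
    (hker : ∀ y, g y = 0 → ∀ a, constantCoeff (y a) = 0) : IsEmpty κ := by
  obtain ⟨σ, hσ⟩ := Module.projective_lifting_property f LinearMap.id hf
  have hσ' : ∀ x, f (σ x) = x := fun x => LinearMap.congr_fun hσ x
  -- The splitting `σ` makes `1 - σ f` a projection onto the image of `g`; its lift `ρ` satisfies `g
  -- ρ g = g`. Thus `y - ρ (g y)` lies in the kernel of `g` and has zero constant terms, and so does
  -- `ρ (g y)`. This is impossible for the constant vector `y = 1` if `κ` is inhabited.
  obtain ⟨ρ, hρ⟩ := g.exists_lift_of_mem_range (LinearMap.id - σ ∘ₗ f) fun x =>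
    (hfg _).mp (by simp [hσ'])
  refine ⟨fun a => ?_⟩
  let y : κ → MvPolynomial V K := fun _ => 1
  have h1 : f (g y) = 0 := (hfg _).mpr ⟨y, rfl⟩
  have h2 : g (y - ρ (g y)) = 0 := by simp [hρ, h1]
  have h3 := hker _ h2 a
  rw [Pi.sub_apply, map_sub, constantCoeff_map_eq_zero ρ (hg y), sub_zero] at h3
  simp [y] at h3

theorem constantCoeff_of_mem_cycles (F : MinimalResolution I) {i : ℕ}
    {x : F.ι i → MvPolynomial V K} (hx : x ∈ F.cycles i) (a) : constantCoeff (x a) = 0 := by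
  obtain ⟨y, rfl⟩ := (F.mem_cycles_iff i x).mp hx
  exact F.minimal i y a

/-- If the basis in position `k + 1` is empty, the cycles in position `k` vanish; dimension shifting
back along the resolution raises the bound by one per step until it reaches `I`. -/
theorem hasProjectiveDimensionLT (F : MinimalResolution I) (k : ℕ) (h : IsEmpty (F.ι k)) :
    HasProjectiveDimensionLT (ModuleCat.of (MvPolynomial V K) I) k := by
  cases k with
  | zero =>
    have : Subsingleton I := F.toIdeal_surjective.subsingleton
    exact (Limits.IsZero.hasProjectiveDimensionLT_zero <| ModuleCat.isZero_of_subsingleton _)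
  | succ k =>
    have key : ∀ j ≤ k, HasProjectiveDimensionLT
        (ModuleCat.of (MvPolynomial V K) (F.cycles (k - j))) j := by
      intro j
      induction j with
      | zero =>
        intro _
        have : Subsingleton (F.cycles k) := (F.toCycles_surjective k).subsingleton
        exact (Limits.IsZero.hasProjectiveDimensionLT_zero <| ModuleCat.isZero_of_subsingleton _)
      | succ j ih =>
        intro hj
        apply hasProjectiveDimensionLT_of_surjective (F.toCycles_surjective (k - (j + 1)))
        rw [F.ker_toCycles, show k - (j + 1) + 1 = k - j by omega]
        exact ih (by omega)
    apply hasProjectiveDimensionLT_of_surjective F.toIdeal_surjective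
    rw [F.ker_toIdeal]
    have := key k le_rfl
    rwa [Nat.sub_self] at this

/-- Dimension shifting makes a syzygy module projective, or `I` itself when `k = 1`, and
`isEmpty_of_projective` applies to the next map. For `k = 0` the ideal is zero, so the constant
vector `1` would be a cycle, against minimality. -/
theorem isEmpty_of_hasProjectiveDimensionLT (F : MinimalResolution I) (k : ℕ)
    (h : HasProjectiveDimensionLT (ModuleCat.of (MvPolynomial V K) I) k) : IsEmpty (F.ι k) := by
  match k, h with
  | 0, h =>
    have hI := ModuleCat.subsingleton_of_isZero (isZero_of_hasProjectiveDimensionLT_zero (ModuleCat.of (MvPolynomial V K) I))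
    refine ⟨fun a => ?_⟩
    have h1 : (fun _ => 1) ∈ F.cycles 0 := by
      rw [← F.ker_toIdeal]
      exact Subsingleton.elim (α := I) _ _
    simpa using F.constantCoeff_of_mem_cycles h1 a
  | 1, h =>
    have := (IsProjective.iff_projective _).mpr (projective_iff_hasProjectiveDimensionLT_one.mpr h)
    refine isEmpty_of_projective F.toIdeal_surjective (g := F.d 0) (fun x => ?_) (F.minimal 0)
      fun y hy => F.constantCoeff_of_mem_cycles (i := 1) hy
    rw [← F.mem_cycles_iff, ← F.ker_toIdeal, LinearMap.mem_ker]
  | k + 2, h =>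
    have key : ∀ j ≤ k, HasProjectiveDimensionLT
        (ModuleCat.of (MvPolynomial V K) (F.cycles j)) (k - j + 1) := by
      intro j
      induction j with
      | zero =>
        intro _
        rw [← F.ker_toIdeal]
        exact hasProjectiveDimensionLT_ker F.toIdeal_surjective h
      | succ j ih =>
        intro hj
        rw [← F.ker_toCycles]
        apply hasProjectiveDimensionLT_ker (F.toCycles_surjective j)
        rw [show k - (j + 1) + 2 = k - j + 1 by omega]
        exact ih (by omega)
    have h1 := key k le_rfl
    rw [Nat.sub_self] at h1
    have := (IsProjective.iff_projective _).mpr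
      (projective_iff_hasProjectiveDimensionLT_one.mpr h1)
    refine isEmpty_of_projective (F.toCycles_surjective k) (g := F.d (k + 1)) (fun x => ?_)
      (F.minimal _) fun y hy => F.constantCoeff_of_mem_cycles (i := k + 2) hy
    rw [← F.mem_cycles_iff, ← F.ker_toCycles, LinearMap.mem_ker]

/-- The projective dimension is the length of a minimal resolution. -/
theorem projdim_eq (F : MinimalResolution I) (k : ℕ) (h : Nonempty (F.ι k))
    (h' : IsEmpty (F.ι (k + 1))) : projdim I = ((k : ℕ∞) : WithBot ℕ∞) := by
  refine le_antisymm ((projectiveDimension_le_iff _ k).mpr (F.hasProjectiveDimensionLT (k + 1) h'))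
    ((projectiveDimension_ge_iff _ k).mpr fun hk => ?_)
  exact (F.isEmpty_of_hasProjectiveDimensionLT k hk).false h.some

end MinimalResolution

/-! ### The mapping cone resolving `x A + y z B` -/

theorem IsHomogeneousVec.zero {K V ι : Type*} [Field K] (w : ι → ℕ) (k : ℤ) :
    IsHomogeneousVec w k (0 : ι → MvPolynomial V K) := by
  intro a e h
  simp at h

theorem isHomogeneousVec_add_const {K V ι : Type*} [Field K] {w : ι → ℕ} {k : ℤ} {t : ℕ}
    {g : ι → MvPolynomial V K} :
    IsHomogeneousVec (fun a => w a + t) k g ↔ IsHomogeneousVec w (k - t) g := by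
  refine forall₂_congr fun a e => imp_congr_right fun _ => ?_
  push_cast
  omega

/-- The linear map into functions on a sum type with the two given components. -/
def LinearMap.sumElim {R M α β : Type*} [CommSemiring R] [AddCommMonoid M] [Module R M]
    (f : M →ₗ[R] (α → R)) (g : M →ₗ[R] (β → R)) : M →ₗ[R] (α ⊕ β → R) :=
  LinearMap.pi (Sum.elim (fun a => LinearMap.proj a ∘ₗ f) (fun b => LinearMap.proj b ∘ₗ g))

theorem LinearMap.sumElim_apply {R M α β : Type*} [CommSemiring R] [AddCommMonoid M] [Module R M]
    (f : M →ₗ[R] (α → R)) (g : M →ₗ[R] (β → R)) (x : M) :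
    f.sumElim g x = Sum.elim (f x) (g x) := by
  funext a
  cases a <;> rfl

/-- The family `Empty, κ 0, κ 1, …`. -/
abbrev shiftedIndex (κ : ℕ → Type) : ℕ → Type
  | 0 => Empty
  | i + 1 => κ i

instance (κ : ℕ → Type) [∀ i, Fintype (κ i)] : ∀ i, Fintype (shiftedIndex κ i)
  | 0 => inferInstanceAs (Fintype Empty)
  | i + 1 => inferInstanceAs (Fintype (κ i))

namespace MinimalResolution

variable {K V : Type*} [Field K] {A B J : Ideal (MvPolynomial V K)}

/-- Cycles are the kernel of a map into a torsion-free module. In the cone this allows a factor `x`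
to be cancelled. -/
theorem mem_cycles_of_smul_mem (F : MinimalResolution A) (i : ℕ) {p : MvPolynomial V K}
    (hp : p ≠ 0) {c : F.ι i → MvPolynomial V K} (h : p • c ∈ F.cycles i) : c ∈ F.cycles i := by
  cases i with
  | zero =>
    have h' : F.aug (p • c) = 0 := h
    rw [map_smul, smul_eq_zero] at h'
    exact h'.resolve_left hp
  | succ i =>
    have h' : F.d i (p • c) = 0 := h
    rw [map_smul, smul_eq_zero] at h'
    exact h'.resolve_left hp

/-- The degrees of the shifted basis elements, raised by `t`. -/
def shiftedDeg (G : MinimalResolution B) (t : ℕ) : ∀ i, shiftedIndex G.ι i → ℕ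
  | 0 => fun a => nomatch a
  | i + 1 => fun a => G.deg i a + t

/-- The differential with values in the shifted complex. -/
noncomputable def shiftedD (G : MinimalResolution B) : ∀ i, (G.ι i → MvPolynomial V K) →ₗ[MvPolynomial V K]
    (shiftedIndex G.ι i → MvPolynomial V K)
  | 0 => 0
  | i + 1 => G.d i

/-- The differential of the mapping cone. -/
noncomputable def coneD (F : MinimalResolution A) (G : MinimalResolution B)
    (φ : ∀ i, (G.ι i → MvPolynomial V K) →ₗ[MvPolynomial V K] (F.ι i → MvPolynomial V K))
    (x y : V) (i : ℕ) :
    ((F.ι (i + 1) ⊕ G.ι (i + 1)) ⊕ G.ι i → MvPolynomial V K) →ₗ[MvPolynomial V K]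
      ((F.ι i ⊕ G.ι i) ⊕ shiftedIndex G.ι i → MvPolynomial V K) :=
  LinearMap.sumElim
    (LinearMap.sumElim
      (F.d i ∘ₗ LinearMap.funLeft _ _ (Sum.inl ∘ Sum.inl) +
        (X y : MvPolynomial V K) • φ i ∘ₗ LinearMap.funLeft _ _ Sum.inr)
      (G.d i ∘ₗ LinearMap.funLeft _ _ (Sum.inl ∘ Sum.inr) -
        (X x : MvPolynomial V K) • LinearMap.funLeft _ _ Sum.inr))
    (-(G.shiftedD i ∘ₗ LinearMap.funLeft _ _ Sum.inr))

theorem coneD_sumElim (F : MinimalResolution A) (G : MinimalResolution B)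
    (φ : ∀ i, (G.ι i → MvPolynomial V K) →ₗ[MvPolynomial V K] (F.ι i → MvPolynomial V K))
    (x y : V) (i : ℕ) (a b c) :
    coneD F G φ x y i (Sum.elim (Sum.elim a b) c) =
      Sum.elim (Sum.elim (F.d i a + (X y : MvPolynomial V K) • φ i c)
        (G.d i b - (X x : MvPolynomial V K) • c)) (-(G.shiftedD i c)) := by
  unfold coneD
  rw [LinearMap.sumElim_apply, LinearMap.sumElim_apply]
  rfl

theorem exists_sumElim_eq {α β γ S : Type*} (g : (α ⊕ β) ⊕ γ → S) :
    ∃ a b c, g = Sum.elim (Sum.elim a b) c :=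
  ⟨g ∘ Sum.inl ∘ Sum.inl, g ∘ Sum.inl ∘ Sum.inr, g ∘ Sum.inr, by
    funext a
    rcases a with (a | a) | a <;> rfl⟩

theorem sumElim_eq_sumElim_iff {α β γ S : Type*} (a a' : α → S) (b b' : β → S) (c c' : γ → S) :
    Sum.elim (Sum.elim a b) c = Sum.elim (Sum.elim a' b') c' ↔ a = a' ∧ b = b' ∧ c = c' := by
  constructor
  · intro h
    exact ⟨funext fun i => congrFun h (Sum.inl (Sum.inl i)),
      funext fun i => congrFun h (Sum.inl (Sum.inr i)), funext fun i => congrFun h (Sum.inr i)⟩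
  · rintro ⟨rfl, rfl, rfl⟩
    rfl

theorem isHomogeneousVec_sumElim_iff {α β γ : Type*} {w : α → ℕ} {w' : β → ℕ} {w'' : γ → ℕ} {k : ℤ}
    (a : α → MvPolynomial V K) (b : β → MvPolynomial V K) (c : γ → MvPolynomial V K) :
    IsHomogeneousVec (Sum.elim (Sum.elim w w') w'') k (Sum.elim (Sum.elim a b) c) ↔
      IsHomogeneousVec w k a ∧ IsHomogeneousVec w' k b ∧ IsHomogeneousVec w'' k c := by
  constructor
  · intro h
    exact ⟨fun i => h (Sum.inl (Sum.inl i)), fun i => h (Sum.inl (Sum.inr i)),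
      fun i => h (Sum.inr i)⟩
  · rintro ⟨h, h', h''⟩ ((i | i) | i)
    exacts [h i, h' i, h'' i]

/-- The mapping cone of `(y φ, -x) : G → F ⊕ G`, where `φ` lifts the multiplication by `z`, is a
minimal resolution of `x A + y z B`. -/
noncomputable def cone (F : MinimalResolution A) (G : MinimalResolution B) {x y : V}
    {z : MvPolynomial V K} {s : ℕ} (hz : z.IsHomogeneous s)
    (hB : ∀ b, X x * b ∈ B → b ∈ B) (hdvd : ∀ p q, X x * p = X y * z * q → X x ∣ q)
    (hJ : ∀ p, p ∈ J ↔ ∃ a ∈ A, ∃ b ∈ B, X x * a + X y * z * b = p)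
    (φ : ∀ i, (G.ι i → MvPolynomial V K) →ₗ[MvPolynomial V K] (F.ι i → MvPolynomial V K))
    (hφ : ∀ i, IsHomogeneousMap (G.deg i) (F.deg i) s (φ i))
    (hφ₀ : ∀ c, F.aug (φ 0 c) = z • G.aug c)
    (hφd : ∀ i c, F.d i (φ (i + 1) c) = φ i (G.d i c)) : MinimalResolution J where
  ι i := (F.ι i ⊕ G.ι i) ⊕ shiftedIndex G.ι i
  deg i := Sum.elim (Sum.elim (fun a => F.deg i a + 1) (fun b => G.deg i b + (s + 1)))
    (G.shiftedDeg (s + 2) i)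
  aug := (X x : MvPolynomial V K) • F.aug ∘ₗ LinearMap.funLeft _ _ (Sum.inl ∘ Sum.inl) +
    (X y * z : MvPolynomial V K) • G.aug ∘ₗ LinearMap.funLeft _ _ (Sum.inl ∘ Sum.inr)
  d := coneD F G φ x y
  mem_iff p := by
    rw [hJ]
    constructor
    · rintro ⟨a, ha, b, hb, rfl⟩
      obtain ⟨a, rfl⟩ := (F.mem_iff _).mp ha
      obtain ⟨b, rfl⟩ := (G.mem_iff _).mp hb
      exact ⟨Sum.elim (Sum.elim a b) 0, rfl⟩
    · rintro ⟨g, rfl⟩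
      obtain ⟨a, b, c, rfl⟩ := exists_sumElim_eq g
      exact ⟨_, (F.mem_iff _).mpr ⟨a, rfl⟩, _, (G.mem_iff _).mpr ⟨b, rfl⟩, rfl⟩
  exact_zero g := by
    obtain ⟨a, b, c, rfl⟩ := exists_sumElim_eq g
    change (X x : MvPolynomial V K) • F.aug a + (X y * z : MvPolynomial V K) • G.aug b = 0 ↔ _
    constructor
    · intro h
      have h0 : X x * F.aug a () + X y * z * G.aug b () = 0 := congrFun h ()
      -- A relation `x a + y z b = 0` forces `b = x q`, and `hB` puts `q` in `B`: this is exactness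
      -- of `0 → B → A ⊕ B → J` in the middle.
      obtain ⟨q, hq⟩ := hdvd (-F.aug a ()) (G.aug b ()) (by linear_combination -h0)
      obtain ⟨c', rfl⟩ := (G.mem_iff _).mp (hB q (by rw [← hq]; exact (G.mem_iff _).mpr ⟨b, rfl⟩))
      have h1 : G.aug (b - (X x : MvPolynomial V K) • c') = 0 := by
        funext _
        simp [hq]
      obtain ⟨b', hb'⟩ := (G.exact_zero _).mp h1
      have h2 : F.aug (a + (X y : MvPolynomial V K) • φ 0 c') = 0 := by
        funext _
        have : X x * (F.aug a () + X y * (z * G.aug c' ())) = 0 := by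
          rw [hq] at h0
          linear_combination h0
        simpa [hφ₀] using (mul_eq_zero.mp this).resolve_left (X_ne_zero x)
      obtain ⟨a', ha'⟩ := (F.exact_zero _).mp h2
      refine ⟨Sum.elim (Sum.elim a' b') (-c'), ?_⟩
      rw [coneD_sumElim, sumElim_eq_sumElim_iff]
      refine ⟨?_, ?_, funext fun e => nomatch e⟩
      · rw [ha', map_neg, smul_neg]; abel
      · rw [hb', smul_neg]; abel
    · rintro ⟨g, hg⟩
      obtain ⟨a', b', c', rfl⟩ := exists_sumElim_eq g
      rw [coneD_sumElim, sumElim_eq_sumElim_iff] at hg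
      obtain ⟨rfl, rfl, -⟩ := hg
      rw [map_add, map_sub, F.aug_d, G.aug_d, map_smul, map_smul, hφ₀]
      simp only [smul_smul, zero_add, zero_sub, smul_neg]
      rw [mul_comm (X y * z) (X x), add_neg_cancel]
  exact_succ i g := by
    obtain ⟨a, b, c, rfl⟩ := exists_sumElim_eq g
    change G.ι i → MvPolynomial V K at c
    constructor
    · intro h
      rw [coneD_sumElim] at h
      have hA : F.d i a + (X y : MvPolynomial V K) • φ i c = 0 :=
        funext fun e => congrFun h (Sum.inl (Sum.inl e))
      have hB' : G.d i b - (X x : MvPolynomial V K) • c = 0 :=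
        funext fun e => congrFun h (Sum.inl (Sum.inr e))
      -- By `hB'`, `x c` is the boundary of `b`, hence a cycle, and so `c` is a cycle.
      have hc : c ∈ G.cycles i := G.mem_cycles_of_smul_mem i (X_ne_zero x) (by
        rw [← sub_eq_zero.mp hB']
        exact (G.mem_cycles_iff i _).mpr ⟨b, rfl⟩)
      obtain ⟨c', rfl⟩ := (G.mem_cycles_iff i _).mp hc
      obtain ⟨b', hb'⟩ := (G.exact_succ i (b - (X x : MvPolynomial V K) • c')).mp (by
        rw [map_sub, map_smul, hB'])
      obtain ⟨a', ha'⟩ := (F.exact_succ i (a + (X y : MvPolynomial V K) • φ (i + 1) c')).mp (by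
        rw [map_add, map_smul, hφd, hA])
      refine ⟨Sum.elim (Sum.elim a' b') (-c'), ?_⟩
      rw [coneD_sumElim]
      refine (sumElim_eq_sumElim_iff _ _ _ _ _ _).mpr ⟨?_, ?_, ?_⟩
      · rw [ha', map_neg, smul_neg]; abel
      · rw [hb', smul_neg]; abel
      · rw [map_neg, neg_neg]; rfl
    · rintro ⟨g, hg⟩
      obtain ⟨a', b', c', rfl⟩ := exists_sumElim_eq g
      change G.ι (i + 1) → MvPolynomial V K at c'
      rw [coneD_sumElim] at hg
      obtain ⟨rfl, rfl, hc⟩ := (sumElim_eq_sumElim_iff _ _ _ _ _ _).mp hg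
      obtain rfl : c = -(G.d i c') := hc.symm
      rw [coneD_sumElim]
      funext e
      have h1 : F.d i (F.d (i + 1) a' + (X y : MvPolynomial V K) • φ (i + 1) c') +
          (X y : MvPolynomial V K) • φ i (-(G.d i c')) = 0 := by
        rw [map_add, F.d_d, map_smul, hφd, map_neg, smul_neg]; abel
      have h2 : G.d i (G.d (i + 1) b' - (X x : MvPolynomial V K) • c') -
          (X x : MvPolynomial V K) • -(G.d i c') = 0 := by
        rw [map_sub, G.d_d, map_smul, smul_neg]; abel
      have h3 : -(G.shiftedD i (-(G.d i c'))) = 0 := by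
        cases i with
        | zero => funext e; exact nomatch e
        | succ i =>
          change -(G.d i (-(G.d (i + 1) c'))) = 0
          rw [map_neg, G.d_d, neg_zero, neg_zero]
      rcases e with (e | e) | e
      exacts [congrFun h1 e, congrFun h2 e, congrFun h3 e]
  aug_homogeneous k g hg := by
    obtain ⟨a, b, c, rfl⟩ := exists_sumElim_eq g
    obtain ⟨ha, hb, -⟩ := (isHomogeneousVec_sumElim_iff _ _ _).mp hg
    have h1 := (F.aug_homogeneous _ _ (isHomogeneousVec_add_const.mp ha)).smul
      (isHomogeneous_X K x)
    have h2 := (G.aug_homogeneous _ _ (isHomogeneousVec_add_const.mp hb)).smul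
      ((isHomogeneous_X K y).mul hz)
    rw [show k - ((1 : ℕ) : ℤ) + 0 + (1 : ℕ) = k + 0 by push_cast; ring] at h1
    rw [show k - ((s + 1 : ℕ) : ℤ) + 0 + ((1 + s : ℕ) : ℤ) = k + 0 by push_cast; ring] at h2
    exact h1.add h2
  d_homogeneous i k g hg := by
    obtain ⟨a, b, c, rfl⟩ := exists_sumElim_eq g
    change G.ι i → MvPolynomial V K at c
    obtain ⟨ha, hb, hc⟩ := (isHomogeneousVec_sumElim_iff _ _ _).mp hg
    have hc' : IsHomogeneousVec (G.deg i) (k - (s + 2 : ℕ)) c := isHomogeneousVec_add_const.mp hc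
    rw [coneD_sumElim]
    refine (isHomogeneousVec_sumElim_iff _ _ _).mpr ⟨?_, ?_, ?_⟩
    · refine isHomogeneousVec_add_const.mpr (IsHomogeneousVec.add ?_ ?_)
      · have := F.d_homogeneous i _ _ (isHomogeneousVec_add_const.mp ha)
        convert this using 1
        ring
      · have := (hφ i _ _ hc').smul (isHomogeneous_X K y)
        convert this using 1
        push_cast
        ring
    · rw [sub_eq_add_neg]
      refine isHomogeneousVec_add_const.mpr (IsHomogeneousVec.add ?_ (IsHomogeneousVec.neg ?_))
      · have := G.d_homogeneous i _ _ (isHomogeneousVec_add_const.mp hb)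
        convert this using 1
        ring
      · have := hc'.smul (isHomogeneous_X K x)
        convert this using 1
        push_cast
        ring
    · refine IsHomogeneousVec.neg ?_
      cases i with
      | zero => exact fun e => nomatch e
      | succ i =>
        refine isHomogeneousVec_add_const.mpr ?_
        have := G.d_homogeneous i _ _ hc'
        rw [add_zero] at this ⊢
        exact this
  minimal i g e := by
    obtain ⟨a, b, c, rfl⟩ := exists_sumElim_eq g
    change G.ι i → MvPolynomial V K at c
    rw [coneD_sumElim]
    rcases e with (e | e) | e
    -- The lift `φ` may have constant entries; the factor `y` removes them, as `x` does for the
    -- identity of `G` below.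
    · change constantCoeff (F.d i a e + X y * φ i c e) = 0
      rw [map_add, F.minimal, map_mul, constantCoeff_X, zero_mul, add_zero]
    · change constantCoeff (G.d i b e - X x * c e) = 0
      rw [map_sub, G.minimal, map_mul, constantCoeff_X, zero_mul, sub_zero]
    · cases i with
      | zero => exact nomatch e
      | succ i =>
        change constantCoeff (-(G.d i c e)) = 0
        rw [map_neg, G.minimal, neg_zero]

theorem card_add_const_eq {α : Type*} (w : α → ℕ) (t j : ℕ) :
    Nat.card {a // w a + t = j} = if t ≤ j then Nat.card {a // w a = j - t} else 0 := by
  split_ifs with h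
  · exact Nat.card_congr (Equiv.subtypeEquivRight fun a => by omega)
  · have : IsEmpty {a // w a + t = j} := ⟨fun a => by have := a.2; omega⟩
    exact Nat.card_of_isEmpty

/-- The minimal resolution of `x A + y z B` and its Betti numbers. -/
theorem exists_resolution_add (F : MinimalResolution A) (G : MinimalResolution B) {x y : V}
    {z : MvPolynomial V K} {s : ℕ} (hz : z.IsHomogeneous s) (hBA : ∀ b ∈ B, z * b ∈ A)
    (hB : ∀ b, X x * b ∈ B → b ∈ B) (hdvd : ∀ p q, X x * p = X y * z * q → X x ∣ q)
    (hJ : ∀ p, p ∈ J ↔ ∃ a ∈ A, ∃ b ∈ B, X x * a + X y * z * b = p) :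
    ∃ R : MinimalResolution J, ∀ i j, R.betti i j =
      (if 1 ≤ j then F.betti i (j - 1) else 0) +
      (if s + 1 ≤ j then G.betti i (j - (s + 1)) else 0) +
      (if 1 ≤ i ∧ s + 2 ≤ j then G.betti (i - 1) (j - (s + 2)) else 0) := by
  obtain ⟨φ, hφ, hφ₀, hφd⟩ := G.exists_chainMap F hz hBA
  refine ⟨cone F G hz hB hdvd hJ φ hφ hφ₀ hφd, fun i j => ?_⟩
  have h1 : (cone F G hz hB hdvd hJ φ hφ hφ₀ hφd).betti i j =
      Nat.card {a // F.deg i a + 1 = j} + Nat.card {a // G.deg i a + (s + 1) = j} +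
        Nat.card {a // G.shiftedDeg (s + 2) i a = j} := by
    rw [← Nat.card_sum, ← Nat.card_sum]
    refine Nat.card_congr ((Equiv.subtypeSum).trans (Equiv.sumCongr Equiv.subtypeSum (Equiv.refl _)))
  rw [h1, card_add_const_eq, card_add_const_eq]
  congr 1
  cases i with
  | zero =>
    rw [if_neg (by omega)]
    have : IsEmpty {a // G.shiftedDeg (s + 2) 0 a = j} := ⟨fun a => nomatch a.1⟩
    exact Nat.card_of_isEmpty
  | succ i =>
    refine (card_add_const_eq (G.deg i) (s + 2) j).trans ?_
    simp [betti]

end MinimalResolution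

/-! ### The resolution of the unit ideal -/

/-- The index types of the resolution of the unit ideal. -/
abbrev unitIndex : ℕ → Type
  | 0 => Unit
  | _ + 1 => Empty

instance : ∀ i, Fintype (unitIndex i)
  | 0 => inferInstanceAs (Fintype Unit)
  | _ + 1 => inferInstanceAs (Fintype Empty)

namespace MinimalResolution

variable (K V : Type*) [Field K]

/-- The minimal resolution of the unit ideal. -/
noncomputable def unit : MinimalResolution (⊤ : Ideal (MvPolynomial V K)) where
  ι := unitIndex
  deg _ _ := 0
  aug := LinearMap.id
  d _ := 0
  mem_iff p := ⟨fun _ => ⟨fun _ => p, rfl⟩, fun _ => trivial⟩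
  exact_zero x := ⟨fun h => ⟨0, h.symm⟩, fun ⟨_, h⟩ => h.symm⟩
  exact_succ i x := ⟨fun _ => ⟨0, funext fun e => nomatch e⟩, fun _ => rfl⟩
  aug_homogeneous k g hg := by
    rw [add_zero]
    exact hg
  d_homogeneous i k g hg := IsHomogeneousVec.zero _ _
  minimal i g a := map_zero _

theorem betti_unit (i j : ℕ) : (unit K V).betti i j = if i = 0 ∧ j = 0 then 1 else 0 := by
  cases i with
  | zero =>
    by_cases hj : j = 0
    · rw [if_pos ⟨rfl, hj⟩]
      exact (Nat.card_congr (Equiv.subtypeUnivEquiv fun a => hj.symm)).trans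
        (Nat.card_unique (α := Unit))
    · rw [if_neg fun h => hj h.2]
      have : IsEmpty {a : (unit K V).ι 0 // (unit K V).deg 0 a = j} := ⟨fun a => hj a.2.symm⟩
      exact Nat.card_of_isEmpty
  | succ i =>
    rw [if_neg fun h => by omega]
    have : IsEmpty {a : (unit K V).ι (i + 1) // (unit K V).deg (i + 1) a = j} :=
      ⟨fun a => nomatch a.1⟩
    exact Nat.card_of_isEmpty

end MinimalResolution

/-! ### Monomial ideals described by their exponents -/

section MonomialIdeal

variable {K V : Type*} [Field K]

/-- The monomial ideal of the polynomials all of whose exponents lie in the upper set `P`. -/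
def monomialIdeal (K : Type*) [Field K] {P : Set (V →₀ ℕ)} (hP : IsUpperSet P) :
    Ideal (MvPolynomial V K) where
  carrier := {p | ∀ e, coeff e p ≠ 0 → e ∈ P}
  zero_mem' e h := absurd (coeff_zero e) h
  add_mem' {p q} hp hq e h := by
    by_cases h0 : coeff e p = 0
    · exact hq e fun h1 => h (by rw [coeff_add, h0, h1, add_zero])
    · exact hp e h0
  smul_mem' r p hp e h := by
    classical
    rw [smul_eq_mul, coeff_mul] at h
    obtain ⟨⟨u, v⟩, huv, hne⟩ := Finset.exists_ne_zero_of_sum_ne_zero h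
    have h3 : u + v = e := Finset.HasAntidiagonal.mem_antidiagonal.mp huv
    exact hP (h3 ▸ le_add_self : v ≤ e) (hp v (right_ne_zero_of_mul hne))

variable {P Q T : Set (V →₀ ℕ)} (hP : IsUpperSet P) (hQ : IsUpperSet Q) (hT : IsUpperSet T)

theorem monomial_mem_monomialIdeal {e : V →₀ ℕ} (he : e ∈ P) (c : K) :
    monomial e c ∈ monomialIdeal K hP := by
  classical
  intro e' h
  rw [coeff_monomial] at h
  have : e = e' := by
    by_contra h'
    exact h (if_neg h')
  rwa [← this]

theorem monomialIdeal_le_iff {I : Ideal (MvPolynomial V K)} :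
    monomialIdeal K hP ≤ I ↔ ∀ e ∈ P, ∀ c, monomial e c ∈ I := by
  refine ⟨fun h e he c => h (monomial_mem_monomialIdeal hP he c), fun h p hp => ?_⟩
  rw [p.as_sum]
  exact I.sum_mem fun e he => h e (hp e (mem_support_iff.mp he)) _

theorem exists_eq_add_of_coeff_monomial_mul {f e : V →₀ ℕ} {p : MvPolynomial V K}
    (h : coeff e (monomial f 1 * p) ≠ 0) : ∃ e', e = f + e' ∧ coeff e' p ≠ 0 := by
  rw [coeff_monomial_mul'] at h
  split_ifs at h with hle
  · obtain ⟨e', rfl⟩ := exists_add_of_le hle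
    refine ⟨e', rfl, ?_⟩
    simpa using h
  · exact absurd rfl h

theorem monomial_mul_mem_monomialIdeal {f : V →₀ ℕ} (h : ∀ e ∈ P, f + e ∈ Q)
    {p : MvPolynomial V K} (hp : p ∈ monomialIdeal K hP) :
    monomial f 1 * p ∈ monomialIdeal K hQ := by
  intro e he
  obtain ⟨e', rfl, he'⟩ := exists_eq_add_of_coeff_monomial_mul he
  exact h e' (hp e' he')

theorem mem_of_monomial_mul_mem {f : V →₀ ℕ} (h : ∀ e, f + e ∈ P → e ∈ P)
    {p : MvPolynomial V K} (hp : monomial f 1 * p ∈ monomialIdeal K hP) :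
    p ∈ monomialIdeal K hP := by
  intro e he
  refine h e (hp _ ?_)
  rwa [coeff_monomial_mul, one_mul]

theorem mem_monomialIdeal_iff_exists_add {f g : V →₀ ℕ}
    (h : ∀ e, e ∈ T ↔ (∃ e' ∈ P, e = f + e') ∨ ∃ e' ∈ Q, e = g + e') (p : MvPolynomial V K) :
    p ∈ monomialIdeal K hT ↔ ∃ a ∈ monomialIdeal K hP, ∃ b ∈ monomialIdeal K hQ,
      monomial f 1 * a + monomial g 1 * b = p := by
  constructor
  · have key : monomialIdeal K hT ≤ Ideal.span {monomial f (1 : K)} * monomialIdeal K hP ⊔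
        Ideal.span {monomial g (1 : K)} * monomialIdeal K hQ := by
      rw [monomialIdeal_le_iff]
      intro e he c
      rcases (h e).mp he with ⟨e', he', rfl⟩ | ⟨e', he', rfl⟩
      · refine Ideal.mem_sup_left (Ideal.mem_span_singleton_mul.mpr
          ⟨monomial e' c, monomial_mem_monomialIdeal hP he' c, ?_⟩)
        rw [monomial_mul, one_mul]
      · refine Ideal.mem_sup_right (Ideal.mem_span_singleton_mul.mpr
          ⟨monomial e' c, monomial_mem_monomialIdeal hQ he' c, ?_⟩)
        rw [monomial_mul, one_mul]
    intro hp
    obtain ⟨u, hu, v, hv, rfl⟩ := Submodule.mem_sup.mp (key hp)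
    obtain ⟨a, ha, rfl⟩ := Ideal.mem_span_singleton_mul.mp hu
    obtain ⟨b, hb, rfl⟩ := Ideal.mem_span_singleton_mul.mp hv
    exact ⟨a, ha, b, hb, rfl⟩
  · rintro ⟨a, ha, b, hb, rfl⟩
    exact Ideal.add_mem _
      (monomial_mul_mem_monomialIdeal hP hT (fun e he => (h _).mpr (Or.inl ⟨e, he, rfl⟩)) ha)
      (monomial_mul_mem_monomialIdeal hQ hT (fun e he => (h _).mpr (Or.inr ⟨e, he, rfl⟩)) hb)

/-- The hypotheses of the cone become conditions on exponents, with `z` the monomial of `f`. Since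
`x ≠ y` and `f x = 0`, the prime `x` does not divide `y z`, which gives the divisibility condition.
-/
theorem exists_resolution_monomialIdeal_add (F : MinimalResolution (monomialIdeal K hP))
    (G : MinimalResolution (monomialIdeal K hQ)) {x y : V} (hxy : x ≠ y) {f : V →₀ ℕ}
    (hfx : f x = 0) (hPQ : ∀ e ∈ Q, f + e ∈ P) (hQx : ∀ e, Finsupp.single x 1 + e ∈ Q → e ∈ Q)
    (h : ∀ e, e ∈ T ↔ (∃ e' ∈ P, e = Finsupp.single x 1 + e') ∨
      ∃ e' ∈ Q, e = (Finsupp.single y 1 + f) + e') :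
    ∃ R : MinimalResolution (monomialIdeal K hT), ∀ i j, R.betti i j =
      (if 1 ≤ j then F.betti i (j - 1) else 0) +
      (if f.degree + 1 ≤ j then G.betti i (j - (f.degree + 1)) else 0) +
      (if 1 ≤ i ∧ f.degree + 2 ≤ j then G.betti (i - 1) (j - (f.degree + 2)) else 0) := by
  refine F.exists_resolution_add G (x := x) (y := y) (z := monomial f 1)
    (isHomogeneous_monomial 1 rfl)
    (fun b hb => monomial_mul_mem_monomialIdeal hQ hP hPQ hb)
    (fun b hb => mem_of_monomial_mul_mem hQ hQx hb) (fun p q hpq => ?_) fun p => ?_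
  · have hdvd : (X x : MvPolynomial V K) ∣ X y * monomial f 1 * q := ⟨p, hpq.symm⟩
    have hprime : Prime (X x : MvPolynomial V K) := X_prime
    rcases hprime.dvd_or_dvd hdvd with h1 | h1
    · rcases hprime.dvd_or_dvd h1 with h2 | h2
      · rw [X_dvd_X] at h2
        exact absurd h2 hxy
      · rw [X_dvd_monomial] at h2
        exact absurd hfx (h2.resolve_left one_ne_zero)
    · exact h1
  · rw [mem_monomialIdeal_iff_exists_add hP hQ hT h]
    simp only [X, monomial_mul, one_mul]

end MonomialIdeal

/-! ### Vertex covers of paths -/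

/-- The exponents whose support covers the edges of the path on the first `m` of `n` vertices. -/
def pathCovers (n m : ℕ) : Set (Fin n →₀ ℕ) :=
  {e | ∀ i j : Fin n, (i : ℕ) + 1 = j → (j : ℕ) < m → e i ≠ 0 ∨ e j ≠ 0}

theorem isUpperSet_pathCovers (n m : ℕ) : IsUpperSet (pathCovers n m) := by
  intro e e' hle he i j hij hj
  have h1 := hle i
  have h2 := hle j
  have h3 := he i j hij hj
  omega

theorem pathCovers_of_le_one {n m : ℕ} (hm : m ≤ 1) : pathCovers n m = Set.univ :=
  Set.eq_univ_of_forall fun e i j hij hj => by omega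

/-- A vertex outside the first `m` lies on none of the edges to be covered, so its variable is a
nonzerodivisor modulo the ideal. -/
theorem mem_of_single_add_mem_pathCovers {n m : ℕ} {x : Fin n} (hx : m ≤ x) {e : Fin n →₀ ℕ}
    (h : Finsupp.single x 1 + e ∈ pathCovers n m) : e ∈ pathCovers n m := by
  intro i j hij hj
  have := h i j hij hj
  have hi : x ≠ i := fun h => by subst h; omega
  have hj' : x ≠ j := fun h => by subst h; omega
  simpa [Finsupp.single_apply, hi, hj'] using this

theorem Finsupp.exists_eq_single_add {α : Type*} {e : α →₀ ℕ} {x : α} (h : e x ≠ 0) :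
    ∃ e', e = Finsupp.single x 1 + e' :=
  exists_add_of_le (Finsupp.single_le_iff.mpr (Nat.one_le_iff_ne_zero.mpr h))

/-- The only new edge ends in `x`; this is the inclusion `z B ⊆ A` of the cone. -/
theorem single_add_mem_pathCovers {n m : ℕ} (x : Fin n) (hx : (x : ℕ) = m) {e : Fin n →₀ ℕ}
    (he : e ∈ pathCovers n m) : Finsupp.single x 1 + e ∈ pathCovers n (m + 1) := by
  intro i j hij hj
  by_cases hjm : (j : ℕ) < m
  · have := he i j hij hjm
    simp only [Finsupp.add_apply]
    omega
  · obtain rfl : j = x := Fin.ext (by omega)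
    right
    simp

/-- The single edge is covered by one of its ends. It fits the same cone with `A = B` the unit ideal
and `z = 1`, whence the trivial summand `0`. -/
theorem mem_pathCovers_two_iff {n : ℕ} (h : 2 ≤ n) (e : Fin n →₀ ℕ) :
    e ∈ pathCovers n 2 ↔
      (∃ e' ∈ pathCovers n 1, e = Finsupp.single ⟨0, by omega⟩ 1 + e') ∨
      ∃ e' ∈ pathCovers n 1, e = (Finsupp.single ⟨1, by omega⟩ 1 + 0) + e' := by
  have h0 : 0 < n := by omega
  rw [pathCovers_of_le_one le_rfl]
  constructor
  · intro he
    rcases he ⟨0, h0⟩ ⟨1, h⟩ rfl (by simp) with h' | h'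
    · obtain ⟨e', he'⟩ := Finsupp.exists_eq_single_add h'
      exact Or.inl ⟨e', trivial, he'⟩
    · obtain ⟨e', he'⟩ := Finsupp.exists_eq_single_add h'
      exact Or.inr ⟨e', trivial, by rw [add_zero]; exact he'⟩
  · rintro (⟨e', -, rfl⟩ | ⟨e', -, rfl⟩) i j hij hj
    · obtain rfl : i = ⟨0, h0⟩ := Fin.ext (by simp; omega)
      left; simp
    · obtain rfl : j = ⟨1, h⟩ := Fin.ext (by simp; omega)
      right; simp

/-- The split according to whether the cover contains `m + 1`. If it does, both edges at `m + 1` are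
covered and the edges among the first `m + 1` vertices remain. If not, `m` and `m + 2` are forced,
and `m` also covers its edge to `m - 1`, leaving the edges among the first `m` vertices. -/
theorem mem_pathCovers_add_three_iff {n m : ℕ} (h : m + 3 ≤ n) (e : Fin n →₀ ℕ) :
    e ∈ pathCovers n (m + 3) ↔
      (∃ e' ∈ pathCovers n (m + 1), e = Finsupp.single ⟨m + 1, by omega⟩ 1 + e') ∨
      ∃ e' ∈ pathCovers n m,
        e = (Finsupp.single ⟨m + 2, by omega⟩ 1 + Finsupp.single ⟨m, by omega⟩ 1) + e' := by
  have l0 : m < n := by omega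
  have l1 : m + 1 < n := by omega
  constructor
  · intro he
    have hm : ∀ k ≤ m + 3, e ∈ pathCovers n k := fun k hk i j hij hj => he i j hij (by omega)
    by_cases h1 : e ⟨m + 1, l1⟩ = 0
    · have h0 := (he ⟨m, l0⟩ ⟨m + 1, l1⟩ rfl (by simp)).resolve_right (by simpa using h1)
      have h2 := (he ⟨m + 1, l1⟩ ⟨m + 2, h⟩ rfl (by simp)).resolve_left
        (by simpa using h1)
      obtain ⟨e₁, rfl⟩ := Finsupp.exists_eq_single_add h2
      have h0' : e₁ ⟨m, l0⟩ ≠ 0 := by simpa [Finsupp.single_apply] using h0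
      obtain ⟨e₂, rfl⟩ := Finsupp.exists_eq_single_add h0'
      refine Or.inr ⟨e₂, ?_, (add_assoc _ _ _).symm⟩
      exact mem_of_single_add_mem_pathCovers (Nat.le_refl m)
        (mem_of_single_add_mem_pathCovers (by simp) (hm m (by omega)))
    · obtain ⟨e', rfl⟩ := Finsupp.exists_eq_single_add h1
      exact Or.inl ⟨e', mem_of_single_add_mem_pathCovers (Nat.le_refl (m + 1)) (hm (m + 1) (by omega)), rfl⟩
  · rintro (⟨e', he', rfl⟩ | ⟨e', he', rfl⟩) i j hij hj
    · simp only [Finsupp.add_apply, Finsupp.single_apply, Fin.ext_iff]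
      by_cases hjm : (j : ℕ) < m + 1
      · have := he' i j hij hjm
        omega
      · by_cases hjm' : (j : ℕ) = m + 1
        · right; rw [if_pos hjm'.symm]; omega
        · left; rw [if_pos (by omega)]; omega
    · simp only [Finsupp.add_apply, Finsupp.single_apply, Fin.ext_iff]
      by_cases hjm : (j : ℕ) < m
      · have := he' i j hij hjm
        omega
      · by_cases hjm' : (j : ℕ) = m + 1
        · left; rw [if_pos (show m = (i : ℕ) by omega)]; omega
        · right
          by_cases h2 : (j : ℕ) = m
          · rw [if_pos h2.symm]; omega
          · rw [if_pos (show m + 2 = (j : ℕ) by omega)]; omega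

/-- The vertex cover ideal of a path as a monomial ideal. -/
theorem vertexCoverIdeal_pathGraph (K : Type*) [Field K] (n : ℕ) :
    vertexCoverIdeal K (SimpleGraph.pathGraph n) =
      monomialIdeal K (isUpperSet_pathCovers n n) := by
  classical
  have hprod : ∀ W : Finset (Fin n), (∏ v ∈ W, X v : MvPolynomial (Fin n) K) =
      monomial (∑ v ∈ W, Finsupp.single v 1) 1 := fun W => by
    rw [monomial_sum_one]
    rfl
  have happly : ∀ (W : Finset (Fin n)) (u : Fin n),
      (∑ v ∈ W, Finsupp.single v 1 : Fin n →₀ ℕ) u = if u ∈ W then 1 else 0 := fun W u => by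
    simp [Finsupp.finsetSum_apply, Finsupp.single_apply]
  apply le_antisymm
  · rw [vertexCoverIdeal, Ideal.span_le]
    rintro _ ⟨W, hW, rfl⟩
    rw [hprod]
    refine monomial_mem_monomialIdeal _ (fun i j hij _ => ?_) 1
    rw [happly, happly]
    have := hW.prop (SimpleGraph.pathGraph_adj.mpr (Or.inl hij))
    simpa using this
  · rw [monomialIdeal_le_iff]
    intro e he c
    -- The support of `e` is a vertex cover, so it contains a minimal one, whose squarefree monomial
    -- divides the monomial of `e`.
    have hcover : (SimpleGraph.pathGraph n).IsVertexCover (e.support : Set (Fin n)) := by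
      intro u v huv
      rcases SimpleGraph.pathGraph_adj.mp huv with h | h
      · simpa using he u v h v.2
      · simpa [or_comm] using he v u h u.2
    obtain ⟨W, hWle, hW⟩ := exists_minimal_le_of_wellFoundedLT
      (fun s : Finset (Fin n) => (SimpleGraph.pathGraph n).IsVertexCover (s : Set (Fin n)))
      e.support hcover
    have hle : (∑ v ∈ W, Finsupp.single v 1 : Fin n →₀ ℕ) ≤ e := by
      intro u
      rw [happly]
      split_ifs with hu
      · exact Nat.one_le_iff_ne_zero.mpr (Finsupp.mem_support_iff.mp (hWle hu))
      · exact Nat.zero_le _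
    obtain ⟨e', rfl⟩ := exists_add_of_le hle
    have : monomial (∑ v ∈ W, Finsupp.single v 1 + e') c =
        monomial e' c * (∏ v ∈ W, X v : MvPolynomial (Fin n) K) := by
      rw [hprod, monomial_mul, mul_one, add_comm]
    rw [this]
    exact Ideal.mul_mem_left _ _ (Ideal.subset_span ⟨W, hW, rfl⟩)

/-! ### The Betti recursion and its extremal values -/

/-- The Betti numbers of the vertex cover ideal of the path on `m` vertices. -/
def pathBetti : ℕ → ℕ → ℕ → ℕ
  | 0, i, j => if i = 0 ∧ j = 0 then 1 else 0
  | 1, i, j => if i = 0 ∧ j = 0 then 1 else 0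
  | 2, i, j =>
    (if 1 ≤ j then pathBetti 1 i (j - 1) else 0) +
    (if 1 ≤ j then pathBetti 1 i (j - 1) else 0) +
    (if 1 ≤ i ∧ 2 ≤ j then pathBetti 1 (i - 1) (j - 2) else 0)
  | m + 3, i, j =>
    (if 1 ≤ j then pathBetti (m + 1) i (j - 1) else 0) +
    (if 2 ≤ j then pathBetti m i (j - 2) else 0) +
    (if 1 ≤ i ∧ 3 ≤ j then pathBetti m (i - 1) (j - 3) else 0)

/-- The number `n` of variables stays fixed while `m` varies, so that the ideals of the shorter
paths live in the same ring as the one being resolved. -/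
theorem exists_resolution_pathCovers (K : Type*) [Field K] (n : ℕ) : ∀ m ≤ n,
    ∃ R : MinimalResolution (monomialIdeal K (isUpperSet_pathCovers n m)),
      ∀ i j, R.betti i j = pathBetti m i j := by
  have htop : ∀ m ≤ 1, monomialIdeal K (isUpperSet_pathCovers n m) = ⊤ := fun m hm =>
    Ideal.eq_top_iff_one _ |>.mpr fun e _ => by
      rw [pathCovers_of_le_one hm]; trivial
  intro m
  induction m using Nat.strong_induction_on with
  | h m ih =>
    intro hm
    match m, ih, hm with
    | 0, _, _ =>
      rw [htop 0 (by omega)]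
      exact ⟨.unit K _, fun i j => by rw [MinimalResolution.betti_unit, pathBetti]⟩
    | 1, _, _ =>
      rw [htop 1 le_rfl]
      exact ⟨.unit K _, fun i j => by rw [MinimalResolution.betti_unit, pathBetti]⟩
    | 2, ih, hm =>
      obtain ⟨F, hF⟩ := ih 1 (by omega) (by omega)
      obtain ⟨R, hR⟩ := exists_resolution_monomialIdeal_add _ _ (isUpperSet_pathCovers n 2) F F
        (x := ⟨0, by omega⟩) (y := ⟨1, by omega⟩) (by simp) (f := 0) rfl
        (fun e _ => by rw [pathCovers_of_le_one le_rfl]; trivial)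
        (fun e _ => by rw [pathCovers_of_le_one le_rfl]; trivial)
        (mem_pathCovers_two_iff hm)
      refine ⟨R, fun i j => ?_⟩
      rw [hR, pathBetti]
      simp only [hF, map_zero, zero_add]
    | m + 3, ih, hm =>
      obtain ⟨F, hF⟩ := ih (m + 1) (by omega) (by omega)
      obtain ⟨G, hG⟩ := ih m (by omega) (by omega)
      obtain ⟨R, hR⟩ := exists_resolution_monomialIdeal_add _ _ (isUpperSet_pathCovers n (m + 3)) F G
        (x := ⟨m + 1, by omega⟩) (y := ⟨m + 2, by omega⟩) (by simp)
        (f := Finsupp.single ⟨m, by omega⟩ 1) (by simp)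
        (fun e he => single_add_mem_pathCovers (m := m) _ rfl he)
        (fun e he => mem_of_single_add_mem_pathCovers (by simp) he)
        (mem_pathCovers_add_three_iff hm)
      refine ⟨R, fun i j => ?_⟩
      rw [hR, pathBetti]
      simp only [hF, hG, Finsupp.degree_single, Nat.reduceAdd]

/-- All three terms of the recursion preserve the inequalities. The last one, from `(m, i - 1, j -
3)` to `(m + 3, i, j)`, raises both sides of the first and of the third inequality equally, which is
why the bounds can be attained. -/
theorem le_of_pathBetti_ne_zero : ∀ m i j, pathBetti m i j ≠ 0 →
    3 * i ≤ m + 1 ∧ i ≤ j ∧ 3 * j ≤ 3 * i + 2 * m := by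
  intro m
  induction m using Nat.strong_induction_on with
  | h m ih =>
    intro i j h
    match m, ih, h with
    | 0, _, h | 1, _, h =>
      rw [pathBetti] at h
      split_ifs at h <;> omega
    | 2, ih, h =>
      have h1 := ih 1 (by omega) i (j - 1)
      have h2 := ih 1 (by omega) (i - 1) (j - 2)
      rw [pathBetti] at h
      split_ifs at h <;> omega
    | m + 3, ih, h =>
      have h1 := ih (m + 1) (by omega) i (j - 1)
      have h2 := ih m (by omega) i (j - 2)
      have h3 := ih m (by omega) (i - 1) (j - 3)
      rw [pathBetti] at h
      split_ifs at h <;> omega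

/-- By `hi`, homological degree `i + 1` is beyond the bound for the path on `m` vertices, so the
middle term of the recursion drops out. -/
theorem pathBetti_add_three (m i j : ℕ) (hi : m + 1 < 3 * (i + 1)) :
    pathBetti (m + 3) (i + 1) (j + 3) = pathBetti (m + 1) (i + 1) (j + 2) + pathBetti m i j := by
  have h := le_of_pathBetti_ne_zero m (i + 1) (j + 1)
  rw [pathBetti]
  simp
  omega

theorem pathBetti_three_mul (k : ℕ) : pathBetti (3 * k) k (3 * k) = 1 := by
  induction k with
  | zero => rfl
  | succ k ih =>
    -- The term of the path on `3 * k + 1` vertices vanishes because `3 * (k + 1) > 3 * k + 2`.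
    have h := le_of_pathBetti_ne_zero (3 * k + 1) (k + 1) (3 * k + 2)
    have := pathBetti_add_three (3 * k) k (3 * k) (by omega)
    rw [show 3 * (k + 1) = 3 * k + 3 by ring]
    omega

theorem pathBetti_three_mul_add_two (k : ℕ) :
    pathBetti (3 * k + 2) (k + 1) (3 * k + 2) = 1 := by
  induction k with
  | zero => simp [pathBetti]
  | succ k ih =>
    have h := le_of_pathBetti_ne_zero (3 * k + 2 + 1) (k + 1 + 1) (3 * k + 2 + 2)
    have := pathBetti_add_three (3 * k + 2) (k + 1) (3 * k + 2) (by omega)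
    rw [show 3 * (k + 1) + 2 = 3 * k + 2 + 3 by ring]
    omega

/-- In this residue class the first term of the recursion survives: it is the extremal Betti number
`1` of the path on `3 * k + 2` vertices, so the value grows by one at each step. -/
theorem pathBetti_three_mul_add_one (k : ℕ) :
    pathBetti (3 * k + 1) k (3 * k) = k + 1 := by
  induction k with
  | zero => simp [pathBetti]
  | succ k ih =>
    have h := pathBetti_three_mul_add_two k
    have : pathBetti (3 * k + 1 + 3) (k + 1) (3 * k + 3) =
        pathBetti (3 * k + 2) (k + 1) (3 * k + 2) + pathBetti (3 * k + 1) k (3 * k) :=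
      pathBetti_add_three (3 * k + 1) k (3 * k) (by omega)
    rw [show 3 * (k + 1) + 1 = 3 * k + 1 + 3 by ring, show 3 * (k + 1) = 3 * k + 3 by ring]
    omega

/-- If the extremal Betti number `β_{k,k+r}` does not vanish, it determines the projective
dimension and the regularity. -/
theorem projdim_regularity_pathGraph (K : Type*) [Field K] (n k r : ℕ) (hk : n + 1 < 3 * (k + 1))
    (hr : 2 * n < 3 * (r + 1)) (h : pathBetti n k (k + r) ≠ 0) :
    projdim (vertexCoverIdeal K (SimpleGraph.pathGraph n)) = ((k : ℕ∞) : WithBot ℕ∞) ∧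
    regularity (vertexCoverIdeal K (SimpleGraph.pathGraph n)) = ((r : ℕ∞) : WithBot ℕ∞) ∧
    gradedBetti (vertexCoverIdeal K (SimpleGraph.pathGraph n)) k (k + r) =
      pathBetti n k (k + r) := by
  rw [vertexCoverIdeal_pathGraph]
  obtain ⟨R, hR⟩ := exists_resolution_pathCovers K n n le_rfl
  have hβ : ∀ i j, gradedBetti (monomialIdeal K (isUpperSet_pathCovers n n)) i j =
      pathBetti n i j := fun i j => (R.gradedBetti_eq i j).trans (hR i j)
  refine ⟨R.projdim_eq k ?_ ?_, ?_, hβ _ _⟩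
  · rw [← hR, MinimalResolution.betti] at h
    exact (Nat.card_ne_zero.mp h).1.map Subtype.val
  · refine ⟨fun a => ?_⟩
    have hne : R.betti (k + 1) (R.deg (k + 1) a) ≠ 0 := by
      rw [MinimalResolution.betti]
      exact Nat.card_ne_zero.mpr ⟨⟨a, rfl⟩, inferInstance⟩
    rw [hR] at hne
    have := le_of_pathBetti_ne_zero _ _ _ hne
    omega
  · apply le_antisymm
    · refine iSup_le fun i => iSup_le fun j => iSup_le fun hij => ?_
      rw [hβ] at hij
      have := le_of_pathBetti_ne_zero _ _ _ hij
      exact_mod_cast (show j ≤ r by omega)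
    · refine le_iSup_of_le k (le_iSup_of_le r (le_iSup_of_le ?_ le_rfl))
      rwa [hβ]

theorem theorem3p7 (K : Type*) [Field K] (n : ℕ) (hn : 1 ≤ n) (k : ℕ) :
    (n = 3 * k →
      projdim (vertexCoverIdeal K (SimpleGraph.pathGraph n)) = ((k : ℕ∞) : WithBot ℕ∞) ∧
      regularity (vertexCoverIdeal K (SimpleGraph.pathGraph n)) =
        ((2 * k : ℕ) : ℕ∞) ∧
      gradedBetti (vertexCoverIdeal K (SimpleGraph.pathGraph n)) k (k + 2 * k) = 1) ∧
    (n = 3 * k - 1 →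
      projdim (vertexCoverIdeal K (SimpleGraph.pathGraph n)) = ((k : ℕ∞) : WithBot ℕ∞) ∧
      regularity (vertexCoverIdeal K (SimpleGraph.pathGraph n)) =
        ((2 * k - 1 : ℕ) : ℕ∞) ∧
      gradedBetti (vertexCoverIdeal K (SimpleGraph.pathGraph n)) k (k + (2 * k - 1)) = 1) ∧
    (n = 3 * k + 1 →
      projdim (vertexCoverIdeal K (SimpleGraph.pathGraph n)) = ((k : ℕ∞) : WithBot ℕ∞) ∧
      regularity (vertexCoverIdeal K (SimpleGraph.pathGraph n)) =
        ((2 * k : ℕ) : ℕ∞) ∧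
      gradedBetti (vertexCoverIdeal K (SimpleGraph.pathGraph n)) k (k + 2 * k) = k + 1) := by
  refine ⟨?_, ?_, ?_⟩
  · rintro rfl
    have h := pathBetti_three_mul k
    rw [show pathBetti (3 * k) k (3 * k) = pathBetti (3 * k) k (k + 2 * k) by
      congr 1; ring] at h
    have := projdim_regularity_pathGraph K (3 * k) k (2 * k) (by omega) (by omega) (by omega)
    rwa [h] at this
  · intro hk
    -- The value `k = 0` would give `n = 0` by truncated subtraction, which `hn` excludes.
    obtain ⟨l, rfl⟩ : ∃ l, k = l + 1 := ⟨k - 1, by omega⟩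
    obtain rfl : n = 3 * l + 2 := by omega
    have h := pathBetti_three_mul_add_two l
    rw [show pathBetti (3 * l + 2) (l + 1) (3 * l + 2) =
      pathBetti (3 * l + 2) (l + 1) (l + 1 + (2 * (l + 1) - 1)) by congr 1; omega] at h
    have := projdim_regularity_pathGraph K (3 * l + 2) (l + 1) (2 * (l + 1) - 1) (by omega) (by omega)
      (by omega)
    rwa [h] at this
  · rintro rfl
    have h := pathBetti_three_mul_add_one k
    rw [show pathBetti (3 * k + 1) k (3 * k) = pathBetti (3 * k + 1) k (k + 2 * k) by
      congr 1; ring] at h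
    have := projdim_regularity_pathGraph K (3 * k + 1) k (2 * k) (by omega) (by omega) (by omega)
    rwa [h] at this
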